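/- **Theorem (Liveness).** During crash-free execution, the operations malloc and free of the allocator Ralloc are lock-free. Here Ralloc is the following concurrent program, executed by finitely many threads on sequentially consistent shared memory, under an arbitrary scheduler (which may suspend threads forever), one shared-memory access per step. *Heap.* The superblock region has room for a fixed number of 64 KB superblocks; a shared word `used` gives the size of the prefix in use. Superblock $d$ has a descriptor with an *anchor* (index of the first block on the superblock's list of free blocks, number of free blocks, and a state EMPTY, PARTIAL or FULL; accessed as one word), a size class (one of finitely many standard classes, or "large"), a block size, and two list pointers. Free blocks of a superblock are linked through their first words. There is one global superblock free list and one partial list per standard class, each a LIFO list of descriptors with an atomically updated head consisting of a pointer and an ABA counter (assumed never to wrap around). Each thread has a private cache of free blocks for each standard class. *malloc($n$), small.* Take a block from the thread's cache for the first class whose blocks hold $n$ bytes. If the cache is empty, first refill it: pop a descriptor from the partial list of the class by CAS; if its superblock is EMPTY, push it to the superblock free list and try again; otherwise set its anchor to FULL by CAS and move all its free blocks into the cache. If the partial list is empty, pop a descriptor from the superblock free list by CAS, record the class and block size in it, set its anchor to FULL by CAS, and move all blocks of the superblock into the cache. If the free list is empty as well, first extend `used` by CAS by a fixed positive increment (or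 by what remains, if that is less) and push the new superblocks to the free list; if the region is exhausted, return null. *malloc($n$), large (no standard class is big enough).* Extend `used` by $\lceil n/64\,\mathrm{KB}\rceil$ superblocks by CAS, record the size in the first descriptor and return the block; return null if there is no room. *free($p$).* If the block is large, push its superblocks to the superblock free list. Otherwise add it to the thread's cache for its class; if this cache is full, first return all its blocks to the free lists of their superblocks, by a CAS on the anchor for each run of cached blocks of the same superblock. A superblock changed from FULL to PARTIAL is then pushed to the partial list, and one changed from FULL to EMPTY to the superblock free list. Every CAS that fails is retried after reloading; flushes and fences do not affect what threads read. An execution starts in any consistent quiescent heap (some blocks possibly in use, all caches empty). The application may call malloc at any time with any size, may call free, from any thread, on any block in use, and may store arbitrary data into blocks in use. *Lock-free* means: (i) in every reachable state, every thread that has called malloc or free and has not yet returned can take a step; and (ii) in every infinite execution in which infinitely many steps are taken inside malloc and free, infinitely many calls of malloc or free complete. -/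

import Mathlib

/-! A small-step, sequentially consistent model of the allocator Ralloc during crash-free execution.
Every step of a thread performs at most one access to shared memory.  Addresses and sizes inside the
superblock region are counted in 64-bit words from the start of the superblock array, and the
`d`-th descriptor belongs to the `d`-th superblock. -/

namespace Ralloc

/-- A superblock has 64 KB, that is, 8192 words of 8 bytes. -/
def sbWords : ℕ := 8192

/-- The parameters of a heap. -/
structure Config where
  /-- number of standard size classes (the class of large blocks is not counted) -/
  numClasses : ℕ
  numClasses_pos : 0 < numClasses
  /-- size, in words, of the blocks of each standard class -/
  classWords : Fin numClasses → ℕ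
  classWords_pos : ∀ c, 0 < classWords c
  classWords_le : ∀ c, classWords c ≤ sbWords
  /-- number of blocks at which a thread-local cache counts as full -/
  cacheCap : Fin numClasses → ℕ
  /-- maximum size of the superblock region, in superblocks -/
  capacity : ℕ
  /-- number of superblocks by which the used prefix is extended to refill the free list -/
  increment : ℕ
  increment_pos : 0 < increment

/-- The size classes of small blocks. -/
abbrev Config.Cls (cfg : Config) : Type := Fin cfg.numClasses

/-- Number of blocks in a superblock of class `c`. -/
def Config.numBlocks (cfg : Config) (c : cfg.Cls) : ℕ := sbWords / cfg.classWords c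

/-- Address of the `i`-th block of superblock `d`, if that superblock has class `c`. -/
def Config.blockAddr (cfg : Config) (c : cfg.Cls) (d i : ℕ) : ℕ :=
  d * sbWords + i * cfg.classWords c

/-- Index, within its superblock, of the block of class `c` at address `a`. -/
def Config.blockIdx (cfg : Config) (c : cfg.Cls) (a : ℕ) : ℕ :=
  (a % sbWords) / cfg.classWords c

/-- The superblock (and hence the descriptor) to which an address belongs. -/
def sbOf (a : ℕ) : ℕ := a / sbWords

/-- The size class that serves a request for `n` bytes; `none` for large requests. -/
def Config.classFor (cfg : Config) (n : ℕ) : Option cfg.Cls :=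
  (List.finRange cfg.numClasses).find? (fun c => n ≤ 8 * cfg.classWords c)

/-- Number of superblocks that a large request for `n` bytes takes: `n / 64 KB`, rounded up. -/
def largeCount (n : ℕ) : ℕ := (n + (8 * sbWords - 1)) / (8 * sbWords)

/-- State of a superblock: entirely free, partially allocated, fully allocated. -/
inductive SBState where
  | EMPTY
  | PARTIAL
  | FULL
  deriving DecidableEq

/-- The anchor of a descriptor, read and updated as one word: the index of the first block on the
block free list of the superblock, the number of blocks on it, and the state. -/
structure Anchor where
  avail : ℕ
  count : ℕ
  state : SBState
  deriving DecidableEq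

/-- The head of a list of descriptors, read and updated as one word: a pointer to the first
descriptor and a counter that excludes the ABA problem. -/
structure Head where
  ptr : Option ℕ
  ctr : ℕ
  deriving DecidableEq

/-- The shared memory. -/
structure Heap (cfg : Config) where
  /-- number of superblocks in the used prefix of the superblock region -/
  used : ℕ
  /-- head of the superblock free list -/
  freeHead : Head
  /-- head of the partial list of each size class -/
  partialHead : cfg.Cls → Head
  /-- the descriptor fields; the size class `none` is the class of large blocks -/
  anchor : ℕ → Anchor
  sizeClass : ℕ → Option cfg.Cls
  blockSize : ℕ → ℕ
  nextFree : ℕ → Option ℕ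
  nextPartial : ℕ → Option ℕ
  /-- the words of the superblocks; the first word of a free block points to the next one -/
  mem : ℕ → ℕ

/-- Where to continue after descriptors have been pushed to the superblock free list. -/
inductive Cont (cfg : Config) where
  /-- pop the superblock free list, for a cache of class `c` -/
  | popFree (c : cfg.Cls)
  /-- pop the partial list of class `c` -/
  | popPartial (c : cfg.Cls)
  /-- go on emptying the cache of class `c`, in order to free `p` -/
  | flush (c : cfg.Cls) (p : ℕ)
  /-- return from `free` -/
  | done

/-- Program counters of a thread, with the values of its local variables. -/
inductive PC (cfg : Config) where
  /-- outside the allocator -/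
  | idle
  /-- about to return `v` (from `malloc`: the block or, for `none`, null; from `free`: `none`) -/
  | ret (v : Option ℕ)
  /-- `malloc` of `n` bytes has been called -/
  | mallocStart (n : ℕ)
  /-- take a block from the cache of class `c`, refilling it if it is empty -/
  | take (c : cfg.Cls)
  /-- pop from the partial list of class `c` -/
  | ppLoad (c : cfg.Cls)
  | ppNext (c : cfg.Cls) (old : Head) (d : ℕ)
  | ppCas (c : cfg.Cls) (old : Head) (d : ℕ) (next : Option ℕ)
  /-- reserve all free blocks of the partial superblock `d` -/
  | rsLoad (c : cfg.Cls) (d : ℕ)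
  | rsCas (c : cfg.Cls) (d : ℕ) (old : Anchor)
  /-- move the `n` reserved blocks that start at `a` into the cache -/
  | walk (c : cfg.Cls) (a n : ℕ)
  /-- pop from the superblock free list -/
  | pfLoad (c : cfg.Cls)
  | pfNext (c : cfg.Cls) (old : Head) (d : ℕ)
  | pfCas (c : cfg.Cls) (old : Head) (d : ℕ) (next : Option ℕ)
  /-- turn `d` into a superblock of class `c` and move all its blocks into the cache -/
  | nsClass (c : cfg.Cls) (d : ℕ)
  | nsSize (c : cfg.Cls) (d : ℕ)
  | nsPersist (c : cfg.Cls) (d : ℕ)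
  | nsLoad (c : cfg.Cls) (d : ℕ)
  | nsCas (c : cfg.Cls) (d : ℕ) (old : Anchor)
  /-- extend the used prefix, from `u` to `v` superblocks, in order to refill the free list -/
  | exLoad (c : cfg.Cls)
  | exCas (c : cfg.Cls) (u v : ℕ)
  | exPersist (c : cfg.Cls) (u v : ℕ)
  /-- link the descriptors `first, …, last` -/
  | link (first last i : ℕ) (k : Cont cfg)
  /-- push the linked descriptors `first, …, last` to the superblock free list -/
  | pushLoad (first last : ℕ) (k : Cont cfg)
  | pushNext (first last : ℕ) (old : Head) (k : Cont cfg)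
  | pushCas (first last : ℕ) (old : Head) (k : Cont cfg)
  /-- allocate a large block of `m` superblocks, starting at superblock `u` -/
  | lgLoad (m : ℕ)
  | lgCas (m u : ℕ)
  | lgPersistUsed (m u : ℕ)
  | lgClass (m u : ℕ)
  | lgSize (m u : ℕ)
  | lgAnchor (u : ℕ)
  | lgPersist (u : ℕ)
  /-- `free` of the block at `p` has been called -/
  | freeStart (p : ℕ)
  /-- free the large block that starts at superblock `d` -/
  | frSize (d : ℕ)
  | frAnchor (d m : ℕ)
  /-- return all blocks of the cache of class `c` to their superblocks, then add `p` to it -/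
  | flush (c : cfg.Cls) (p : ℕ)
  /-- collect consecutive cached blocks of superblock `d` into a chain of `n` blocks -/
  | gather (c : cfg.Cls) (p d head tail n : ℕ)
  /-- push that chain to the block free list of superblock `d` -/
  | flLoad (c : cfg.Cls) (p d head tail n : ℕ)
  | flNext (c : cfg.Cls) (p d head tail n : ℕ) (old : Anchor)
  | flCas (c : cfg.Cls) (p d head tail n : ℕ) (old : Anchor)
  /-- push `d` to the partial list of class `c` -/
  | qpLoad (c : cfg.Cls) (p d : ℕ)
  | qpNext (c : cfg.Cls) (p d : ℕ) (old : Head)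
  | qpCas (c : cfg.Cls) (p d : ℕ) (old : Head)

/-- The program point at which a continuation starts. -/
def Cont.pc {cfg : Config} : Cont cfg → PC cfg
  | .popFree c => .pfLoad c
  | .popPartial c => .ppLoad c
  | .flush c p => .flush c p
  | .done => .ret none

/-- The thread-local caches of one thread: for each class, a stack of free blocks. -/
abbrev Caches (cfg : Config) : Type := cfg.Cls → List ℕ

/-- The anchor of a superblock of class `c` all of whose blocks have been taken. -/
def fullAnchor (cfg : Config) (c : cfg.Cls) : Anchor := ⟨cfg.numBlocks c, 0, .FULL⟩

/-- The anchor after `n` blocks, the first of which is at `head`, have been pushed to the block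
free list of a superblock of class `c` whose anchor was `old`. -/
def pushAnchor (cfg : Config) (c : cfg.Cls) (old : Anchor) (head n : ℕ) : Anchor :=
  ⟨cfg.blockIdx c head, old.count + n,
    if old.count + n = cfg.numBlocks c then .EMPTY else .PARTIAL⟩

/-- One step of a thread inside `malloc` or `free`.  Flushes and fences (`…Persist…`) have no effect
on the contents of memory as the threads see it. -/
def exec {cfg : Config} (h : Heap cfg) (q : Caches cfg) :
    PC cfg → PC cfg × Heap cfg × Caches cfg
  -- outside the allocator, or about to return
  | .idle => (.idle, h, q)
  | .ret v => (.ret v, h, q)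
  -- entry of malloc
  | .mallocStart n =>
    match cfg.classFor n with
    | some c => (.take c, h, q)
    | none => (.lgLoad (largeCount n), h, q)
  -- small blocks come from the cache
  | .take c =>
    match q c with
    | b :: L => (.ret (some b), h, Function.update q c L)
    | [] => (.ppLoad c, h, q)
  -- pop a descriptor from the partial list; if there is none, take a new superblock
  | .ppLoad c =>
    match (h.partialHead c).ptr with
    | some d => (.ppNext c (h.partialHead c) d, h, q)
    | none => (.pfLoad c, h, q)
  | .ppNext c old d => (.ppCas c old d (h.nextPartial d), h, q)
  | .ppCas c old d next =>
    if h.partialHead c = old then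
      (.rsLoad c d,
        { h with partialHead := Function.update h.partialHead c ⟨next, old.ctr + 1⟩ }, q)
    else (.ppLoad c, h, q)
  -- retire the superblock if it has become empty, otherwise reserve its free blocks
  | .rsLoad c d =>
    if (h.anchor d).state = .EMPTY then (.link d d d (.popPartial c), h, q)
    else (.rsCas c d (h.anchor d), h, q)
  | .rsCas c d old =>
    if h.anchor d = old then
      (.walk c (cfg.blockAddr c d old.avail) old.count,
        { h with anchor := Function.update h.anchor d (fullAnchor cfg c) }, q)
    else (.rsLoad c d, h, q)
  | .walk c _ 0 => (.take c, h, q)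
  | .walk c a (n + 1) => (.walk c (h.mem a) n, h, Function.update q c (a :: q c))
  -- pop a descriptor from the superblock free list; if there is none, extend the used prefix
  | .pfLoad c =>
    match h.freeHead.ptr with
    | some d => (.pfNext c h.freeHead d, h, q)
    | none => (.exLoad c, h, q)
  | .pfNext c old d => (.pfCas c old d (h.nextFree d), h, q)
  | .pfCas c old d next =>
    if h.freeHead = old then
      (.nsClass c d, { h with freeHead := ⟨next, old.ctr + 1⟩ }, q)
    else (.pfLoad c, h, q)
  -- prepare the new superblock
  | .nsClass c d =>
    (.nsSize c d, { h with sizeClass := Function.update h.sizeClass d (some c) }, q)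
  | .nsSize c d =>
    (.nsPersist c d, { h with blockSize := Function.update h.blockSize d (cfg.classWords c) }, q)
  | .nsPersist c d => (.nsLoad c d, h, q)
  | .nsLoad c d => (.nsCas c d (h.anchor d), h, q)
  | .nsCas c d old =>
    if h.anchor d = old then
      (.take c, { h with anchor := Function.update h.anchor d (fullAnchor cfg c) },
        Function.update q c ((List.range (cfg.numBlocks c)).map (cfg.blockAddr c d) ++ q c))
    else (.nsLoad c d, h, q)
  -- extend the used prefix; if the region is exhausted, malloc returns null
  | .exLoad c =>
    if h.used < cfg.capacity then
      (.exCas c h.used (min (h.used + cfg.increment) cfg.capacity), h, q)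
    else (.ret none, h, q)
  | .exCas c u v =>
    if h.used = u then (.exPersist c u v, { h with used := v }, q) else (.exLoad c, h, q)
  | .exPersist c u v => (.link u (v - 1) u (.popFree c), h, q)
  -- push a chain of descriptors to the superblock free list
  | .link first last i k =>
    if i < last then
      (.link first last (i + 1) k,
        { h with nextFree := Function.update h.nextFree i (some (i + 1)) }, q)
    else (.pushLoad first last k, h, q)
  | .pushLoad first last k => (.pushNext first last h.freeHead k, h, q)
  | .pushNext first last old k =>
    (.pushCas first last old k,
      { h with nextFree := Function.update h.nextFree last old.ptr }, q)
  | .pushCas first last old k =>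
    if h.freeHead = old then (k.pc, { h with freeHead := ⟨some first, old.ctr + 1⟩ }, q)
    else (.pushLoad first last k, h, q)
  -- large blocks; if the region is exhausted, malloc returns null
  | .lgLoad m =>
    if h.used + m ≤ cfg.capacity then (.lgCas m h.used, h, q) else (.ret none, h, q)
  | .lgCas m u =>
    if h.used = u then (.lgPersistUsed m u, { h with used := u + m }, q) else (.lgLoad m, h, q)
  | .lgPersistUsed m u => (.lgClass m u, h, q)
  | .lgClass m u =>
    (.lgSize m u, { h with sizeClass := Function.update h.sizeClass u none }, q)
  | .lgSize m u =>
    (.lgAnchor u, { h with blockSize := Function.update h.blockSize u (m * sbWords) }, q)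
  | .lgAnchor u =>
    (.lgPersist u, { h with anchor := Function.update h.anchor u ⟨0, 0, .FULL⟩ }, q)
  | .lgPersist u => (.ret (some (u * sbWords)), h, q)
  -- entry of free
  | .freeStart p =>
    match h.sizeClass (sbOf p) with
    | none => (.frSize (sbOf p), h, q)
    | some c =>
      if (q c).length < cfg.cacheCap c then (.ret none, h, Function.update q c (p :: q c))
      else (.flush c p, h, q)
  -- a large block is split into its superblocks
  | .frSize d => (.frAnchor d (h.blockSize d / sbWords), h, q)
  | .frAnchor d m =>
    (.link d (d + m - 1) d .done,
      { h with anchor := Function.update h.anchor d ⟨0, 0, .EMPTY⟩ }, q)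
  -- empty the cache
  | .flush c p =>
    match q c with
    | [] => (.ret none, h, Function.update q c [p])
    | b :: L => (.gather c p (sbOf b) b b 1, h, Function.update q c L)
  | .gather c p d head tail n =>
    match q c with
    | [] => (.flLoad c p d head tail n, h, q)
    | b :: L =>
      if sbOf b = d then
        (.gather c p d b tail (n + 1), { h with mem := Function.update h.mem b head },
          Function.update q c L)
      else (.flLoad c p d head tail n, h, q)
  | .flLoad c p d head tail n => (.flNext c p d head tail n (h.anchor d), h, q)
  | .flNext c p d head tail n old =>
    (.flCas c p d head tail n old,
      { h with mem := Function.update h.mem tail (cfg.blockAddr c d old.avail) }, q)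
  | .flCas c p d head tail n old =>
    if h.anchor d = old then
      (if old.state = .FULL then
          (if (pushAnchor cfg c old head n).state = .EMPTY then .link d d d (.flush c p)
            else .qpLoad c p d)
        else .flush c p,
        { h with anchor := Function.update h.anchor d (pushAnchor cfg c old head n) }, q)
    else (.flLoad c p d head tail n, h, q)
  -- push a descriptor to the partial list
  | .qpLoad c p d => (.qpNext c p d (h.partialHead c), h, q)
  | .qpNext c p d old =>
    (.qpCas c p d old, { h with nextPartial := Function.update h.nextPartial d old.ptr }, q)
  | .qpCas c p d old =>
    if h.partialHead c = old then
      (.flush c p,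
        { h with partialHead := Function.update h.partialHead c ⟨some d, old.ctr + 1⟩ }, q)
    else (.qpLoad c p d, h, q)

/-- A state of the whole system with threads `T`. -/
structure Sys (cfg : Config) (T : Type*) where
  heap : Heap cfg
  pc : T → PC cfg
  cache : T → Caches cfg
  /-- the blocks in use: returned by `malloc` and not yet passed to `free` -/
  live : Set ℕ

/-- What can happen in one step. -/
inductive Event (T : Type*) where
  /-- thread `t` calls `malloc` for `n` bytes -/
  | callMalloc (t : T) (n : ℕ)
  /-- thread `t` calls `free` on the block at `p` -/
  | callFree (t : T) (p : ℕ)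
  /-- thread `t` executes a step of `malloc` or `free` -/
  | internal (t : T)
  /-- the current operation of thread `t` returns -/
  | response (t : T) (v : Option ℕ)
  /-- the application stores `w` in the word at `x` -/
  | store (x w : ℕ)

/-- The thread whose allocator code an event executes. -/
def Event.thread? {T : Type*} : Event T → Option T
  | .callMalloc t _ => some t
  | .callFree t _ => some t
  | .internal t => some t
  | .response t _ => some t
  | .store _ _ => none

/-- The event is a step of some thread inside `malloc` or `free`. -/
def Event.IsInternal {T : Type*} (e : Event T) : Prop := ∃ t, e = .internal t

/-- The event is the completion of some call of `malloc` or `free`. -/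
def Event.IsResponse {T : Type*} (e : Event T) : Prop := ∃ t v, e = .response t v

/-- The transitions of the system.  The application calls `free` only on blocks in use, and it
stores only into blocks in use; otherwise it is unrestricted, as is the scheduler. -/
inductive Step {cfg : Config} {T : Type*} [DecidableEq T] :
    Sys cfg T → Event T → Sys cfg T → Prop
  | callMalloc (s : Sys cfg T) (t : T) (n : ℕ) (idle : s.pc t = .idle) :
      Step s (.callMalloc t n) { s with pc := Function.update s.pc t (.mallocStart n) }
  | callFree (s : Sys cfg T) (t : T) (p : ℕ) (idle : s.pc t = .idle) (inUse : p ∈ s.live) :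
      Step s (.callFree t p)
        { s with pc := Function.update s.pc t (.freeStart p), live := s.live \ {p} }
  | internal (s : Sys cfg T) (t : T) (not_idle : s.pc t ≠ .idle)
      (not_ret : ∀ v, s.pc t ≠ .ret v) :
      Step s (.internal t)
        { s with
          heap := (exec s.heap (s.cache t) (s.pc t)).2.1
          pc := Function.update s.pc t (exec s.heap (s.cache t) (s.pc t)).1
          cache := Function.update s.cache t (exec s.heap (s.cache t) (s.pc t)).2.2 }
  | response (s : Sys cfg T) (t : T) (v : Option ℕ) (at_ret : s.pc t = .ret v) :
      Step s (.response t v)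
        { s with pc := Function.update s.pc t .idle, live := s.live ∪ {a | v = some a} }
  | store (s : Sys cfg T) (a x w : ℕ) (inUse : a ∈ s.live) (lower : a ≤ x)
      (upper : x < a + s.heap.blockSize (sbOf a)) :
      Step s (.store x w)
        { s with heap := { s.heap with mem := Function.update s.heap.mem x w } }

/-- The list of descriptors `L` is linked through `next`, starting from the pointer given. -/
def Linked (next : ℕ → Option ℕ) : Option ℕ → List ℕ → Prop
  | o, [] => o = none
  | o, d :: L => o = some d ∧ Linked next (next d) L

/-- The list of blocks `L` is linked through the first words of its blocks, starting from the
address given.  (The end of a block free list is known from the number of its blocks.) -/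
def Chained (mem : ℕ → ℕ) : ℕ → List ℕ → Prop
  | _, [] => True
  | a, b :: L => a = b ∧ Chained mem (mem b) L

/-- What a superblock is used for. -/
inductive Kind (cfg : Config) where
  /-- it is on the superblock free list -/
  | free
  /-- it consists of blocks of class `c` -/
  | small (c : cfg.Cls)
  /-- it is part of the large block that starts at superblock `e` -/
  | large (e : ℕ)

/-- The descriptor of a quiescent superblock `d` of class `c` is consistent: the block free list
holds exactly the blocks that are not in use, and the anchor agrees with it. -/
structure SmallOK {cfg : Config} (h : Heap cfg) (live : Set ℕ) (c : cfg.Cls) (d : ℕ) : Prop where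
  sizeClass_eq : h.sizeClass d = some c
  blockSize_eq : h.blockSize d = cfg.classWords c
  freeBlocks : ∃ L : List ℕ, L.Nodup ∧ L.length = (h.anchor d).count ∧
    Chained h.mem (cfg.blockAddr c d (h.anchor d).avail) L ∧
    ∀ a, a ∈ L ↔ (∃ i < cfg.numBlocks c, a = cfg.blockAddr c d i) ∧ a ∉ live
  full_iff : (h.anchor d).state = .FULL ↔ (h.anchor d).count = 0
  empty_iff : (h.anchor d).state = .EMPTY ↔ (h.anchor d).count = cfg.numBlocks c

/-- The descriptor of a large block in use that starts at superblock `e` is consistent. -/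
structure LargeOK {cfg : Config} (h : Heap cfg) (live : Set ℕ) (kind : ℕ → Kind cfg) (e : ℕ) :
    Prop where
  sizeClass_eq : h.sizeClass e = none
  inUse : e * sbWords ∈ live
  extent : ∃ m, 0 < m ∧ h.blockSize e = m * sbWords ∧ e + m ≤ h.used ∧
    ∀ d < h.used, kind d = .large e ↔ e ≤ d ∧ d < e + m

/-- A heap with blocks `live` in use that is consistent while no operation is active and all
thread-local caches are empty.  This is how a heap is found after a fresh start, a clean restart
or a completed recovery. -/
structure WellFormed {cfg : Config} (h : Heap cfg) (live : Set ℕ) (kind : ℕ → Kind cfg)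
    (freeL : List ℕ) (partL : cfg.Cls → List ℕ) : Prop where
  used_le : h.used ≤ cfg.capacity
  free_linked : Linked h.nextFree h.freeHead.ptr freeL
  free_nodup : freeL.Nodup
  mem_free : ∀ d, d ∈ freeL ↔ d < h.used ∧ kind d = .free
  part_linked : ∀ c, Linked h.nextPartial (h.partialHead c).ptr (partL c)
  part_nodup : ∀ c, (partL c).Nodup
  mem_part : ∀ c d, d ∈ partL c ↔
    d < h.used ∧ kind d = .small c ∧ (h.anchor d).state ≠ .FULL
  small_ok : ∀ d < h.used, ∀ c, kind d = .small c → SmallOK h live c d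
  large_ok : ∀ d < h.used, ∀ e, kind d = .large e → LargeOK h live kind e
  live_block : ∀ a ∈ live,
    (∃ d < h.used, ∃ c, kind d = .small c ∧ ∃ i < cfg.numBlocks c, a = cfg.blockAddr c d i) ∨
      ∃ e < h.used, kind e = .large e ∧ a = e * sbWords

/-- The states in which an execution may start. -/
def Sys.IsInitial {cfg : Config} {T : Type*} (s : Sys cfg T) : Prop :=
  (∀ t, s.pc t = .idle) ∧ (∀ t c, s.cache t c = []) ∧
    ∃ kind freeL partL, WellFormed s.heap s.live kind freeL partL

/-- The states that occur in crash-free executions. -/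
inductive Reachable {cfg : Config} {T : Type*} [DecidableEq T] : Sys cfg T → Prop
  | initial (s : Sys cfg T) : s.IsInitial → Reachable s
  | step (s s' : Sys cfg T) (e : Event T) : Reachable s → Step s e s' → Reachable s'

/-- An infinite crash-free execution under an arbitrary scheduler; `state n` and `state (n + 1)`
are the states before and after `event n`. -/
structure Execution (cfg : Config) (T : Type*) [DecidableEq T] where
  state : ℕ → Sys cfg T
  event : ℕ → Event T
  initial : (state 0).IsInitial
  step : ∀ n, Step (state n) (event n) (state (n + 1))

/-- Lock freedom of `malloc` and `free`: a thread that has called one of them is never blocked, that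
is, it can always take its next step, whatever the other threads are doing; and if the threads take
infinitely many steps inside `malloc` and `free`, then infinitely many calls complete. -/
def LockFree (cfg : Config) (T : Type*) [DecidableEq T] : Prop :=
  (∀ s : Sys cfg T, Reachable s → ∀ t, s.pc t ≠ .idle →
    ∃ e s', e.thread? = some t ∧ Step s e s') ∧
  ∀ x : Execution cfg T,
    (∃ᶠ n in Filter.atTop, (x.event n).IsInternal) →
      ∃ᶠ n in Filter.atTop, (x.event n).IsResponse

end Ralloc

/-! Clause (i) holds because `exec` is total: a thread inside the allocator either returns or
executes its next step (`exists_step`).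

For clause (ii), suppose that from some moment on no call completes. A retry loop fails only if
another step has changed the word it compares, so it suffices to bound the number of changes to such
words and the number of steps between two changes. A pair of natural numbers, ordered
lexicographically, does both. The first, `potential`, adds up a `weight` for each thread, which pays
for the changes it can still make before it returns, and two units for every superblock that the
region still has room for and every superblock on a partial list. These units pay for the only loops
inside a single call that `weight` alone cannot bound: popping EMPTY superblocks from a partial list
over and over, and extending the prefix while other threads take the new superblocks. The second
number, `distance`, adds up `steps`, the time each thread needs to reach its next change if left
undisturbed. By `exec_measure`, a step lowers the potential, or it changes none of these words and
brings its thread closer to a change while the terms of the other threads stay the same. Calls lower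
the potential too, and stores by the application affect neither number. Hence only finitely many
steps can be taken without a response (`Execution.false_of_no_response`).

The delicate point is that a successful pop really shortens a partial list. The CAS must install the
true successor, and a superblock must never be on two lists or twice on one. This needs most of the
functional correctness of the allocator, which is proved by rely-guarantee reasoning with ghost
ownership: each superblock and each block has one owner, `GInv` ties the owners to the memory,
`PCInv` states what a thread knows at each program point, and `Stable` lists what it may rely on
while others run. `Stable.pcInv` shows that interference preserves this knowledge, and
`exec_invariant` that each step preserves everything and changes the total length of the partial
lists by exactly its pushes and pops. Two facts carry the argument: the counters in the list heads
exclude stale successors, and an EMPTY superblock has all its blocks on its own free list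
(`SmallInv.place_of_empty`), so that no thread still holds one of them when the superblock is
recycled. -/

namespace Ralloc

variable {cfg : Config} {T : Type*}

/-! ### Ghost ownership of superblocks and blocks -/

/-- The role of a superblock of blocks with respect to the partial list of its class. -/
inductive Status (T : Type*) where
  /-- it is neither on the list nor about to be pushed to it -/
  | full
  /-- it is on the list -/
  | listed
  /-- it has been popped by the thread `t`, or `t` is about to push it -/
  | held (t : T)

/-- The owner of a superblock. -/
inductive Own (cfg : Config) (T : Type*) where
  /-- it lies beyond the used prefix -/
  | unused
  /-- it is on the superblock free list -/
  | free
  /-- only the thread `t` accesses it -/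
  | excl (t : T)
  /-- it is part of the large block that starts at superblock `e` -/
  | large (e : ℕ)
  /-- it consists of blocks of class `c` -/
  | small (c : cfg.Cls) (st : Status T)

/-- The owner of a block. -/
inductive Place (cfg : Config) (T : Type*) where
  /-- it is on the block free list of its superblock -/
  | chain
  /-- it is in use -/
  | live
  /-- it is in the cache of class `c` of thread `t` -/
  | cached (t : T) (c : cfg.Cls)
  /-- it is the argument of `free`, or the result of `malloc`, in thread `t` -/
  | param (t : T)
  /-- it belongs to the chain that thread `t` is moving into or out of its cache -/
  | seg (t : T)

/-- The thread that owns a block. -/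
def Place.thread? {cfg : Config} {T : Type*} : Place cfg T → Option T
  | .chain => none
  | .live => none
  | .cached t _ => some t
  | .param t => some t
  | .seg t => some t

/-- Auxiliary state that records who owns which superblock and which block. -/
structure Ghost (cfg : Config) (T : Type*) where
  own : ℕ → Own cfg T
  -- A label matters only at addresses that are blocks according to `own`; all other addresses may
  -- carry any label.
  place : ℕ → Place cfg T
  freeL : List ℕ
  partL : cfg.Cls → List ℕ


/-! ### Invariants of the memory and of the threads -/

/-- `a` is the address of a block of class `c` in its superblock. -/
def IsAddr (cfg : Config) (c : cfg.Cls) (a : ℕ) : Prop :=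
  ∃ i < cfg.numBlocks c, a = cfg.blockAddr c (sbOf a) i

/-- `a` is the address of a block of a superblock of class `c`. -/
def SBlock (γ : Ghost cfg T) (c : cfg.Cls) (a : ℕ) : Prop :=
  (∃ st, γ.own (sbOf a) = .small c st) ∧ IsAddr cfg c a

/-- `a` is the address of a large block. -/
def LBlock (γ : Ghost cfg T) (a : ℕ) : Prop :=
  γ.own (sbOf a) = .large (sbOf a) ∧ a = sbOf a * sbWords

/-- The descriptor of the superblock `d` of class `c` is consistent. -/
structure SmallInv (h : Heap cfg) (γ : Ghost cfg T) (c : cfg.Cls) (d : ℕ) (st : Status T) :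
    Prop where
  sizeClass_eq : h.sizeClass d = some c
  blockSize_eq : h.blockSize d = cfg.classWords c
  -- No converse is recorded. That an EMPTY superblock has all its blocks in `L` follows by
  -- counting.
  chain : ∃ L : List ℕ, L.Nodup ∧ L.length = (h.anchor d).count ∧
    Chained h.mem (cfg.blockAddr c d (h.anchor d).avail) L ∧
    ∀ a ∈ L, γ.place a = .chain ∧ sbOf a = d ∧ IsAddr cfg c a
  full_iff : (h.anchor d).state = .FULL ↔ st = .full
  empty : (h.anchor d).state = .EMPTY → (h.anchor d).count = cfg.numBlocks c

/-- The large block that starts at superblock `e` is consistent. -/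
def LargeInv (h : Heap cfg) (γ : Ghost cfg T) (e : ℕ) : Prop :=
  h.sizeClass e = none ∧ ∃ m, 0 < m ∧ h.blockSize e = m * sbWords ∧
    ∀ d, γ.own d = .large e ↔ e ≤ d ∧ d < e + m

/-- The invariant of the shared memory. -/
structure GInv (h : Heap cfg) (live : Set ℕ) (γ : Ghost cfg T) : Prop where
  unused : ∀ d, h.used ≤ d → γ.own d = .unused
  free_linked : Linked h.nextFree h.freeHead.ptr γ.freeL
  free_nodup : γ.freeL.Nodup
  -- One direction suffices, here and for the partial lists: a lost superblock would do no harm to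
  -- progress.
  mem_free : ∀ d ∈ γ.freeL, γ.own d = .free
  part_linked : ∀ c, Linked h.nextPartial (h.partialHead c).ptr (γ.partL c)
  part_nodup : ∀ c, (γ.partL c).Nodup
  mem_part : ∀ c, ∀ d ∈ γ.partL c, γ.own d = .small c .listed
  small : ∀ d c st, γ.own d = .small c st → SmallInv h γ c d st
  large : ∀ d e, γ.own d = .large e → LargeInv h γ e
  live_block : ∀ a ∈ live, γ.place a = .live ∧ ((∃ c, SBlock γ c a) ∨ LBlock γ a)

/-- The cached blocks of thread `t` belong to it. -/
def CacheInv (γ : Ghost cfg T) (t : T) (q : Caches cfg) : Prop :=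
  ∀ c, (q c).Nodup ∧ ∀ a ∈ q c, γ.place a = .cached t c ∧ SBlock γ c a

/-- The block of class `c` at `p` is held by thread `t`. -/
def SmallParam (γ : Ghost cfg T) (t : T) (c : cfg.Cls) (p : ℕ) : Prop :=
  γ.place p = .param t ∧ SBlock γ c p

/-- The large block at `p` is held by thread `t`. -/
def LargeParam (γ : Ghost cfg T) (t : T) (p : ℕ) : Prop :=
  γ.place p = .param t ∧ LBlock γ p

/-- The superblocks `u, …, v - 1` are owned by thread `t`. -/
def Range (γ : Ghost cfg T) (t : T) (u v : ℕ) : Prop :=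
  ∀ d, u ≤ d → d < v → γ.own d = .excl t

/-- The thread `t` owns the chain `L` of blocks of class `c`, starting at `a`. -/
def Segment (h : Heap cfg) (γ : Ghost cfg T) (t : T) (c : cfg.Cls) (a : ℕ) (L : List ℕ) : Prop :=
  L.Nodup ∧ Chained h.mem a L ∧ ∀ x ∈ L, γ.place x = .seg t ∧ SBlock γ c x

/-- The invariant of a chain of `n` blocks of superblock `d`, from `head` to `tail`, that is to be
returned to `d`. -/
def ReturnInv (h : Heap cfg) (γ : Ghost cfg T) (t : T) (c : cfg.Cls) (p d head tail n : ℕ) :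
    Prop :=
  SmallParam γ t c p ∧ ∃ L, Segment h γ t c head (L ++ [tail]) ∧ L.length + 1 = n ∧
    ∀ x ∈ L ++ [tail], sbOf x = d

/-- The descriptors `first, …, last` belong to `t` and are linked from `first` up to `i`. -/
def LinkInv (h : Heap cfg) (γ : Ghost cfg T) (t : T) (first last i : ℕ) : Prop :=
  first ≤ i ∧ i ≤ last ∧ Range γ t first (last + 1) ∧
    ∀ j, first ≤ j → j < i → h.nextFree j = some (j + 1)

/-- The invariant of a continuation. -/
def ContInv (γ : Ghost cfg T) (t : T) : Cont cfg → Prop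
  | .flush c p => SmallParam γ t c p
  | _ => True

/-- The invariant of thread `t` at each program point. -/
def PCInv (h : Heap cfg) (γ : Ghost cfg T) (t : T) : PC cfg → Prop
  | .ret (some v) => (∃ c, SmallParam γ t c v) ∨ LargeParam γ t v
  | .ppNext c old d => old.ptr = some d ∧ old.ctr ≤ (h.partialHead c).ctr
  -- The bound on the counter keeps the implication stable: once the counter exceeds `old.ctr`, the
  -- head can never again equal `old`, and a stale `next` is harmless.
  | .ppCas c old d next => (old.ptr = some d ∧ old.ctr ≤ (h.partialHead c).ctr) ∧
      (h.partialHead c = old → h.nextPartial d = next)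
  | .rsLoad c d => γ.own d = .small c (.held t)
  -- Nothing is remembered about the anchor read earlier. A successful CAS shows that it is the
  -- current one, so a recurring anchor value does no harm.
  | .rsCas c d _ => γ.own d = .small c (.held t)
  | .walk c a n => ∃ L, Segment h γ t c a L ∧ L.length = n
  | .pfNext _ old d => old.ptr = some d ∧ old.ctr ≤ h.freeHead.ctr
  | .pfCas _ old d next => (old.ptr = some d ∧ old.ctr ≤ h.freeHead.ctr) ∧
      (h.freeHead = old → h.nextFree d = next)
  | .nsClass _ d => γ.own d = .excl t
  | .nsSize c d => γ.own d = .excl t ∧ h.sizeClass d = some c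
  | .nsPersist c d => γ.own d = .excl t ∧ h.sizeClass d = some c ∧
      h.blockSize d = cfg.classWords c
  | .nsLoad c d => γ.own d = .excl t ∧ h.sizeClass d = some c ∧ h.blockSize d = cfg.classWords c
  | .nsCas c d _ => γ.own d = .excl t ∧ h.sizeClass d = some c ∧ h.blockSize d = cfg.classWords c
  | .exCas _ u v => u < v ∧ v ≤ cfg.capacity
  | .exPersist _ u v => u < v ∧ Range γ t u v
  | .link first last i k => LinkInv h γ t first last i ∧ ContInv γ t k
  | .pushLoad first last k => LinkInv h γ t first last last ∧ ContInv γ t k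
  | .pushNext first last _ k => LinkInv h γ t first last last ∧ ContInv γ t k
  | .pushCas first last old k => (LinkInv h γ t first last last ∧ h.nextFree last = old.ptr) ∧
      ContInv γ t k
  | .lgLoad m => 0 < m
  | .lgCas m u => 0 < m ∧ u + m ≤ cfg.capacity
  | .lgPersistUsed m u => 0 < m ∧ Range γ t u (u + m)
  | .lgClass m u => 0 < m ∧ Range γ t u (u + m)
  | .lgSize m u => 0 < m ∧ Range γ t u (u + m) ∧ h.sizeClass u = none
  | .lgAnchor u => LargeParam γ t (u * sbWords)
  | .lgPersist u => LargeParam γ t (u * sbWords)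
  | .freeStart p => (∃ c, SmallParam γ t c p) ∨ LargeParam γ t p
  | .frSize d => LargeParam γ t (d * sbWords)
  | .frAnchor d m => LargeParam γ t (d * sbWords) ∧ h.blockSize d = m * sbWords
  | .flush c p => SmallParam γ t c p
  | .gather c p d head tail n => ReturnInv h γ t c p d head tail n
  | .flLoad c p d head tail n => ReturnInv h γ t c p d head tail n
  | .flNext c p d head tail n _ => ReturnInv h γ t c p d head tail n
  | .flCas c p d head tail n old => ReturnInv h γ t c p d head tail n ∧
      h.mem tail = cfg.blockAddr c d old.avail
  | .qpLoad c p d => SmallParam γ t c p ∧ γ.own d = .small c (.held t)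
  | .qpNext c p d _ => SmallParam γ t c p ∧ γ.own d = .small c (.held t)
  | .qpCas c p d old => (SmallParam γ t c p ∧ γ.own d = .small c (.held t)) ∧
      h.nextPartial d = old.ptr
  | _ => True

/-! ### Interference between threads -/

/-- What the thread `t` may rely on while others take steps. -/
structure Stable (t : T) (h : Heap cfg) (γ : Ghost cfg T) (h' : Heap cfg) (γ' : Ghost cfg T) :
    Prop where
  excl : ∀ d, γ.own d = .excl t → γ'.own d = .excl t ∧ h'.sizeClass d = h.sizeClass d ∧
    h'.blockSize d = h.blockSize d ∧ h'.nextFree d = h.nextFree d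
  held : ∀ d c, γ.own d = .small c (.held t) → γ'.own d = .small c (.held t) ∧
    h'.nextPartial d = h.nextPartial d
  block : ∀ a c, (γ.place a).thread? = some t → SBlock γ c a →
    γ'.place a = γ.place a ∧ SBlock γ' c a ∧ h'.mem a = h.mem a
  large : ∀ a, γ.place a = .param t → LBlock γ a → γ'.place a = .param t ∧ LBlock γ' a ∧
    h'.blockSize (sbOf a) = h.blockSize (sbOf a)
  -- Either every CAS prepared with the old head is bound to fail, or the successor read for it is
  -- still right.
  free : h.freeHead.ctr < h'.freeHead.ctr ∨ (h'.freeHead = h.freeHead ∧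
    ∀ d, h.freeHead.ptr = some d → h'.nextFree d = h.nextFree d)
  part : ∀ c, (h.partialHead c).ctr < (h'.partialHead c).ctr ∨
    (h'.partialHead c = h.partialHead c ∧
      ∀ d, (h.partialHead c).ptr = some d → h'.nextPartial d = h.nextPartial d)

/-! ### Arithmetic of block addresses -/

lemma sbWords_pos : 0 < sbWords := by norm_num [sbWords]

lemma numBlocks_pos (c : cfg.Cls) : 0 < cfg.numBlocks c :=
  Nat.div_pos (cfg.classWords_le c) (cfg.classWords_pos c)

/-- `numBlocks` rounds down, so the last block also ends inside the superblock. -/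
lemma block_bound {c : cfg.Cls} {i : ℕ} (hi : i < cfg.numBlocks c) :
    i * cfg.classWords c + cfg.classWords c ≤ sbWords := by
  have h1 : (i + 1) * cfg.classWords c ≤ cfg.numBlocks c * cfg.classWords c :=
    Nat.mul_le_mul_right _ hi
  have h2 : cfg.numBlocks c * cfg.classWords c ≤ sbWords := Nat.div_mul_le_self _ _
  rw [Nat.succ_mul] at h1
  omega

lemma sbOf_add {d x : ℕ} (hx : x < sbWords) : sbOf (d * sbWords + x) = d := by
  unfold sbOf
  rw [Nat.mul_comm, Nat.mul_add_div sbWords_pos, Nat.div_eq_of_lt hx, Nat.add_zero]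

@[simp] lemma sbOf_mul (d : ℕ) : sbOf (d * sbWords) = d := Nat.mul_div_cancel d sbWords_pos

lemma sbOf_blockAddr {c : cfg.Cls} {d i : ℕ} (hi : i < cfg.numBlocks c) :
    sbOf (cfg.blockAddr c d i) = d := by
  have := block_bound hi
  have := cfg.classWords_pos c
  exact sbOf_add (by omega)

lemma blockIdx_blockAddr {c : cfg.Cls} {d i : ℕ} (hi : i < cfg.numBlocks c) :
    cfg.blockIdx c (cfg.blockAddr c d i) = i := by
  have := block_bound hi
  have := cfg.classWords_pos c
  unfold Config.blockIdx Config.blockAddr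
  rw [Nat.mul_comm d, Nat.mul_add_mod, Nat.mod_eq_of_lt (by omega),
    Nat.mul_div_cancel _ (cfg.classWords_pos c)]

lemma isAddr_blockAddr {c : cfg.Cls} {d i : ℕ} (hi : i < cfg.numBlocks c) :
    IsAddr cfg c (cfg.blockAddr c d i) := ⟨i, hi, by rw [sbOf_blockAddr hi]⟩

lemma IsAddr.blockAddr_blockIdx {c : cfg.Cls} {a : ℕ} (ha : IsAddr cfg c a) :
    cfg.blockAddr c (sbOf a) (cfg.blockIdx c a) = a := by
  obtain ⟨i, hi, e⟩ := ha
  generalize sbOf a = d at e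
  subst e
  rw [blockIdx_blockAddr hi]

/-- Two blocks of the same superblock do not overlap. -/
lemma IsAddr.eq_of_overlap {c : cfg.Cls} {a b : ℕ} (ha : IsAddr cfg c a) (hb : IsAddr cfg c b)
    (hs : sbOf a = sbOf b) (h1 : a ≤ b) (h2 : b < a + cfg.classWords c) : a = b := by
  obtain ⟨i, hi, e⟩ := ha
  obtain ⟨j, hj, e'⟩ := hb
  rw [← hs] at e'
  generalize sbOf a = d at e e'
  unfold Config.blockAddr at e e'
  have : i = j := by
    by_contra hne
    rcases Nat.lt_or_gt_of_ne hne with hl | hl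
    · have := Nat.mul_le_mul_right (cfg.classWords c) hl
      rw [Nat.succ_mul] at this
      omega
    · have := Nat.mul_le_mul_right (cfg.classWords c) hl
      rw [Nat.succ_mul] at this
      have := cfg.classWords_pos c
      omega
  rw [e, e', this]

/-- Blocks do not cross superblock boundaries. Hence a store into a block of a small class stays
within its superblock. -/
lemma IsAddr.sbOf_eq_of_lt {c : cfg.Cls} {a x : ℕ} (ha : IsAddr cfg c a) (h1 : a ≤ x)
    (h2 : x < a + cfg.classWords c) : sbOf x = sbOf a := by
  obtain ⟨i, hi, e⟩ := ha
  generalize sbOf a = d at e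
  have := block_bound hi
  obtain ⟨y, rfl⟩ := Nat.exists_eq_add_of_le h1
  subst e
  unfold Config.blockAddr
  rw [Nat.add_assoc]
  exact sbOf_add (by omega)

/-! ### Lists linked through memory -/

lemma Chained.congr {mem mem' : ℕ → ℕ} {L : List ℕ} {a : ℕ} (h : Chained mem a L)
    (e : ∀ x ∈ L, mem' x = mem x) : Chained mem' a L := by
  induction L generalizing a with
  | nil => trivial
  | cons b L ih =>
    refine ⟨h.1, ?_⟩
    rw [e b (by simp)]
    exact ih h.2 fun x hx => e x (by simp [hx])

/-- The last block is singled out because its first word is the only link that the first chain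
leaves open. -/
lemma Chained.append {mem : ℕ → ℕ} {L M : List ℕ} {a b x : ℕ} (h : Chained mem a (L ++ [x]))
    (hx : mem x = b) (hM : Chained mem b M) : Chained mem a (L ++ [x] ++ M) := by
  induction L generalizing a with
  | nil => exact ⟨h.1, by simpa [hx] using hM⟩
  | cons c L ih => exact ⟨h.1, ih h.2⟩

lemma Linked.congr {next next' : ℕ → Option ℕ} {L : List ℕ} {o : Option ℕ} (h : Linked next o L)
    (e : ∀ x ∈ L, next' x = next x) : Linked next' o L := by
  induction L generalizing o with
  | nil => exact h
  | cons b L ih =>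
    refine ⟨h.1, ?_⟩
    rw [e b (by simp)]
    exact ih h.2 fun x hx => e x (by simp [hx])

lemma Linked.of_some {next : ℕ → Option ℕ} {L : List ℕ} {d : ℕ} (h : Linked next (some d) L) :
    ∃ M, L = d :: M ∧ Linked next (next d) M := by
  cases L with
  | nil => simp [Linked] at h
  | cons b L =>
    obtain ⟨h1, h2⟩ := h
    cases h1
    exact ⟨L, rfl, h2⟩

/-- The invariant of a descriptor reads only its class, size and anchor, and the labels and first
words of the blocks on its free list. Any step that spares these preserves it. -/
lemma SmallInv.frame {h h' : Heap cfg} {γ γ' : Ghost cfg T} {c : cfg.Cls} {d : ℕ}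
    {st : Status T} (i : SmallInv h γ c d st) (e1 : h'.sizeClass d = h.sizeClass d)
    (e2 : h'.blockSize d = h.blockSize d) (e3 : h'.anchor d = h.anchor d)
    (e4 : ∀ a, γ.place a = .chain → sbOf a = d → IsAddr cfg c a →
      γ'.place a = .chain ∧ h'.mem a = h.mem a) : SmallInv h' γ' c d st := by
  obtain ⟨i1, i2, ⟨L, l1, l2, l3, l4⟩, i4, i5⟩ := i
  refine ⟨e1 ▸ i1, e2 ▸ i2, ⟨L, l1, e3 ▸ l2, ?_, ?_⟩, by rwa [e3], by rwa [e3]⟩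
  · rw [e3]
    exact l3.congr fun x hx => (e4 x (l4 x hx).1 (l4 x hx).2.1 (l4 x hx).2.2).2
  · intro a ha
    obtain ⟨h1, h2, h3⟩ := l4 a ha
    exact ⟨(e4 a h1 h2 h3).1, h2, h3⟩

/-- All blocks of an empty superblock are on its block free list. -/
lemma SmallInv.place_of_empty {h : Heap cfg} {γ : Ghost cfg T} {c : cfg.Cls} {d : ℕ}
    {st : Status T} (i : SmallInv h γ c d st) (e : (h.anchor d).state = .EMPTY) {a : ℕ}
    (ha : sbOf a = d) (ha' : IsAddr cfg c a) : γ.place a = .chain := by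
  obtain ⟨L, l1, l2, l3, l4⟩ := i.chain
  rw [i.empty e] at l2
  -- Pigeonhole: the list has no repetition and as many entries as the superblock has blocks, so it
  -- contains every block.
  have hsub : L.toFinset ⊆ (Finset.range (cfg.numBlocks c)).image (cfg.blockAddr c d) := by
    intro x hx
    obtain ⟨-, h2, j, hj, h3⟩ := l4 x (by simpa using hx)
    rw [h2] at h3
    exact Finset.mem_image.2 ⟨j, by simpa using hj, h3.symm⟩
  have heq := Finset.eq_of_subset_of_card_le hsub (by
    rw [List.toFinset_card_of_nodup l1, l2]
    exact Finset.card_image_le.trans (by simp))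
  obtain ⟨j, hj, h3⟩ := ha'
  have : a ∈ L.toFinset := by
    rw [heq, h3, ha]
    exact Finset.mem_image_of_mem _ (by simpa using hj)
  exact (l4 a (by simpa using this)).1

/-! ### Stability of the invariants under interference -/

lemma Stable.refl (t : T) (h : Heap cfg) (γ : Ghost cfg T) : Stable t h γ h γ :=
  ⟨by simp, by simp, by simp, by simp +contextual, by simp, by simp⟩

section
variable {t : T} {h h' h'' : Heap cfg} {γ γ' γ'' : Ghost cfg T}

lemma Stable.trans (s : Stable t h γ h' γ') (s' : Stable t h' γ' h'' γ'') :
    Stable t h γ h'' γ'' := by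
  refine ⟨fun d e => ?_, fun d c e => ?_, fun a c e b => ?_, fun a e b => ?_, ?_, fun c => ?_⟩
  · have h1 := s.excl d e
    have h2 := s'.excl d h1.1
    grind
  · have h1 := s.held d c e
    have h2 := s'.held d c h1.1
    grind
  · have h1 := s.block a c e b
    have h2 := s'.block a c (h1.1 ▸ e) h1.2.1
    grind
  · have h1 := s.large a e b
    have h2 := s'.large a h1.1 h1.2.1
    grind
  · have h1 := s.free
    have h2 := s'.free
    grind
  · have h1 := s.part c
    have h2 := s'.part c
    grind

lemma Stable.smallParam (s : Stable t h γ h' γ') {c : cfg.Cls} {p : ℕ}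
    (i : SmallParam γ t c p) : SmallParam γ' t c p := by
  have := s.block p c (by rw [i.1]; rfl) i.2
  exact ⟨this.1.trans i.1, this.2.1⟩

lemma Stable.largeParam (s : Stable t h γ h' γ') {p : ℕ}
    (i : LargeParam γ t p) : LargeParam γ' t p :=
  have := s.large p i.1 i.2
  ⟨this.1, this.2.1⟩

lemma Stable.cacheInv (s : Stable t h γ h' γ') {q : Caches cfg} (i : CacheInv γ t q) :
    CacheInv γ' t q := by
  refine fun c => ⟨(i c).1, fun a ha => ?_⟩
  obtain ⟨h1, h2⟩ := (i c).2 a ha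
  have := s.block a c (by rw [h1]; rfl) h2
  exact ⟨this.1.trans h1, this.2.1⟩

lemma Stable.segment (s : Stable t h γ h' γ') {c : cfg.Cls} {a : ℕ} {L : List ℕ}
    (i : Segment h γ t c a L) : Segment h' γ' t c a L := by
  obtain ⟨i1, i2, i3⟩ := i
  have key := fun x hx => s.block x c (by rw [(i3 x hx).1]; rfl) (i3 x hx).2
  exact ⟨i1, i2.congr fun x hx => (key x hx).2.2,
    fun x hx => ⟨(key x hx).1.trans (i3 x hx).1, (key x hx).2.1⟩⟩

lemma Stable.returnInv (s : Stable t h γ h' γ') {c : cfg.Cls} {p d head tail n : ℕ}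
    (i : ReturnInv h γ t c p d head tail n) : ReturnInv h' γ' t c p d head tail n := by
  obtain ⟨i1, L, i2, i3⟩ := i
  exact ⟨s.smallParam i1, L, s.segment i2, i3⟩

lemma Stable.range (s : Stable t h γ h' γ') {u v : ℕ} (i : Range γ t u v) : Range γ' t u v :=
  fun d h1 h2 => (s.excl d (i d h1 h2)).1

lemma Stable.linkInv (s : Stable t h γ h' γ') {f l j : ℕ} (i : LinkInv h γ t f l j) :
    LinkInv h' γ' t f l j := by
  obtain ⟨i1, i2, i3, i4⟩ := i
  exact ⟨i1, i2, s.range i3, fun x h1 h2 =>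
    (s.excl x (i3 x h1 (by omega))).2.2.2.trans (i4 x h1 h2)⟩

lemma Stable.contInv (s : Stable t h γ h' γ') {k : Cont cfg} (i : ContInv γ t k) :
    ContInv γ' t k := by
  cases k with
  | flush c p => exact s.smallParam i
  | _ => trivial

/-- Each clause of `PCInv` speaks of superblocks and blocks owned by the thread, of a list head
guarded by its counter, or of constants; `Stable` covers all of these. -/
lemma Stable.pcInv (s : Stable t h γ h' γ') {pc : PC cfg} (i : PCInv h γ t pc) :
    PCInv h' γ' t pc := by
  have hp := fun c => s.part c
  have hf := s.free
  cases pc with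
  | ret v =>
    cases v with
    | none => trivial
    | some v =>
      rcases i with ⟨c, i⟩ | i
      · exact .inl ⟨c, s.smallParam i⟩
      · exact .inr (s.largeParam i)
  | ppNext c old d => have := hp c; simp only [PCInv] at i ⊢; grind
  | ppCas c old d next => have := hp c; simp only [PCInv] at i ⊢; grind
  | pfNext c old d => simp only [PCInv] at i ⊢; grind
  | pfCas c old d next => simp only [PCInv] at i ⊢; grind
  | rsLoad c d => exact (s.held d c i).1
  | rsCas c d => exact (s.held d c i).1
  | walk c a n => exact i.imp fun L hL => ⟨s.segment hL.1, hL.2⟩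
  | nsClass c d => exact (s.excl d i).1
  | nsSize c d => have := s.excl d i.1; simp only [PCInv] at i ⊢; grind
  | nsPersist c d => have := s.excl d i.1; simp only [PCInv] at i ⊢; grind
  | nsLoad c d => have := s.excl d i.1; simp only [PCInv] at i ⊢; grind
  | nsCas c d => have := s.excl d i.1; simp only [PCInv] at i ⊢; grind
  | exPersist c u v => exact ⟨i.1, s.range i.2⟩
  | link f l j k => exact ⟨s.linkInv i.1, s.contInv i.2⟩
  | pushLoad f l k => exact ⟨s.linkInv i.1, s.contInv i.2⟩
  | pushNext f l old k => exact ⟨s.linkInv i.1, s.contInv i.2⟩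
  | pushCas f l old k =>
    obtain ⟨⟨i1, i2⟩, i3⟩ := i
    exact ⟨⟨s.linkInv i1, (s.excl l (i1.2.2.1 l i1.1 (by omega))).2.2.2.trans i2⟩, s.contInv i3⟩
  | lgPersistUsed m u => exact ⟨i.1, s.range i.2⟩
  | lgClass m u => exact ⟨i.1, s.range i.2⟩
  | lgSize m u =>
    obtain ⟨i1, i2, i3⟩ := i
    exact ⟨i1, s.range i2, (s.excl u (i2 u le_rfl (by omega))).2.1.trans i3⟩
  | lgAnchor u => exact s.largeParam i
  | lgPersist u => exact s.largeParam i
  | freeStart p =>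
    rcases i with ⟨c, i⟩ | i
    · exact .inl ⟨c, s.smallParam i⟩
    · exact .inr (s.largeParam i)
  | frSize d => exact s.largeParam i
  | frAnchor d m =>
    have := (s.large _ i.1.1 i.1.2).2.2
    rw [sbOf_mul] at this
    exact ⟨s.largeParam i.1, this.trans i.2⟩
  | flush c p => exact s.smallParam i
  | gather c p d head tail n => exact s.returnInv i
  | flLoad c p d head tail n => exact s.returnInv i
  | flNext c p d head tail n old => exact s.returnInv i
  | flCas c p d head tail n old =>
    obtain ⟨i1, i2⟩ := i
    refine ⟨s.returnInv i1, ?_⟩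
    obtain ⟨-, L, ⟨-, -, i3⟩, -⟩ := i1
    have := i3 tail (by simp)
    exact (s.block tail c (by rw [this.1]; rfl) this.2).2.2.trans i2
  | qpLoad c p d => exact ⟨s.smallParam i.1, (s.held d c i.2).1⟩
  | qpNext c p d old => exact ⟨s.smallParam i.1, (s.held d c i.2).1⟩
  | qpCas c p d old =>
    have := s.held d c i.1.2
    exact ⟨⟨s.smallParam i.1.1, this.1⟩, this.2.trans i.2⟩
  | _ => exact i
end

/-! ### Changes of labels and writes to owned memory -/

/-- A change made by thread `t` that preserves the invariant of the shared memory and on which the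
other threads may rely. -/
structure Trans (t : T) (live : Set ℕ) (h : Heap cfg) (γ : Ghost cfg T) (h' : Heap cfg)
    (γ' : Ghost cfg T) : Prop where
  ginv : GInv h' live γ'
  stable : ∀ t', t' ≠ t → Stable t' h γ h' γ'

/-- The cached blocks of `t` and its parameter are kept. -/
def Keep (t : T) (γ γ' : Ghost cfg T) : Prop :=
  -- The label `.seg t` is left out: that chain is exactly what the acting thread acquires or gives
  -- away.
  ∀ a c, γ.place a = .param t ∨ (∃ c', γ.place a = .cached t c') → SBlock γ c a →
    γ'.place a = γ.place a ∧ SBlock γ' c a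

section
variable {t : T} {live : Set ℕ} {h h' h'' : Heap cfg} {γ γ' γ'' : Ghost cfg T}

lemma Keep.cacheInv (k : Keep t γ γ') {q : Caches cfg} (i : CacheInv γ t q) :
    CacheInv γ' t q := by
  refine fun c => ⟨(i c).1, fun a ha => ?_⟩
  obtain ⟨h1, h2⟩ := (i c).2 a ha
  have := k a c (.inr ⟨c, h1⟩) h2
  exact ⟨this.1.trans h1, this.2⟩

lemma Keep.smallParam (k : Keep t γ γ') {c : cfg.Cls} {p : ℕ} (i : SmallParam γ t c p) :
    SmallParam γ' t c p :=
  have := k p c (.inl i.1) i.2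
  ⟨this.1.trans i.1, this.2⟩

lemma Keep.trans (k : Keep t γ γ') (k' : Keep t γ' γ'') : Keep t γ γ'' := by
  intro a c e b
  have h1 := k a c e b
  have h2 := k' a c (h1.1.symm ▸ e) h1.2
  exact ⟨h2.1.trans h1.1, h2.2⟩

lemma Trans.refl (G : GInv h live γ) : Trans t live h γ h γ :=
  ⟨G, fun t' _ => Stable.refl t' h γ⟩

lemma Trans.trans (s : Trans t live h γ h' γ') (s' : Trans t live h' γ' h'' γ'') :
    Trans t live h γ h'' γ'' :=
  ⟨s'.ginv, fun t' ne => (s.stable t' ne).trans (s'.stable t' ne)⟩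

lemma GInv.freeL_of_ptr (G : GInv h live γ) {d : ℕ} (e : h.freeHead.ptr = some d) :
    ∃ M, γ.freeL = d :: M ∧ Linked h.nextFree (h.nextFree d) M :=
  Linked.of_some (e ▸ G.free_linked)

lemma GInv.partL_of_ptr (G : GInv h live γ) {c : cfg.Cls} {d : ℕ}
    (e : (h.partialHead c).ptr = some d) :
    ∃ M, γ.partL c = d :: M ∧ Linked h.nextPartial (h.nextPartial d) M :=
  Linked.of_some (e ▸ G.part_linked c)

lemma GInv.own_free_ptr (G : GInv h live γ) {d : ℕ} (e : h.freeHead.ptr = some d) :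
    γ.own d = .free := by
  obtain ⟨M, e1, -⟩ := G.freeL_of_ptr e
  exact G.mem_free d (by simp [e1])

lemma GInv.own_part_ptr (G : GInv h live γ) {c : cfg.Cls} {d : ℕ}
    (e : (h.partialHead c).ptr = some d) : γ.own d = .small c .listed := by
  obtain ⟨M, e1, -⟩ := G.partL_of_ptr e
  exact G.mem_part c d (by simp [e1])

lemma LargeInv.own_self {e : ℕ} (i : LargeInv h γ e) : γ.own e = .large e := by
  obtain ⟨-, m, h1, -, h2⟩ := i
  exact (h2 e).2 ⟨le_rfl, by omega⟩

/-- A thread may change the role of a block that it owns. -/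
lemma GInv.updatePlace (G : GInv h live γ) {a : ℕ} {x : Place cfg T}
    (ha : (γ.place a).thread? = some t) :
    Trans t live h γ h { γ with place := Function.update γ.place a x } := by
  have hne : γ.place a ≠ .chain := by rintro e; simp [e, Place.thread?] at ha
  have hne' : γ.place a ≠ .live := by rintro e; simp [e, Place.thread?] at ha
  refine ⟨⟨G.unused, G.free_linked, G.free_nodup, G.mem_free, G.part_linked, G.part_nodup,
    G.mem_part, fun d c st e => (G.small d c st e).frame rfl rfl rfl fun b hb _ _ => ?_,
    G.large, fun b hb => ?_⟩, fun t' ne => ⟨by simp, by simp, fun b c hb hs => ?_,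
      fun b hb hs => ?_, by simp, by simp⟩⟩
  · have : b ≠ a := by rintro rfl; exact hne hb
    simp [this, hb]
  · have h1 := G.live_block b hb
    have : b ≠ a := by rintro rfl; exact hne' h1.1
    exact ⟨(Function.update_of_ne this _ _).trans h1.1, h1.2⟩
  · have : b ≠ a := by rintro rfl; simp_all
    exact ⟨Function.update_of_ne this _ _, hs, rfl⟩
  · have : b ≠ a := by rintro rfl; simp_all [Place.thread?]
    exact ⟨(Function.update_of_ne this _ _).trans hb, hs, rfl⟩

lemma GInv.writeMem (G : GInv h live γ) {b w : ℕ} (hb : γ.place b = .seg t) :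
    Trans t live h γ { h with mem := Function.update h.mem b w } γ := by
  refine ⟨⟨G.unused, G.free_linked, G.free_nodup, G.mem_free, G.part_linked, G.part_nodup,
    G.mem_part, fun d c st e => (G.small d c st e).frame rfl rfl rfl fun a ha _ _ => ?_,
    G.large, G.live_block⟩, fun t' ne => ⟨by simp, by simp, fun a c ha hs => ?_,
      by simp +contextual, by simp, by simp⟩⟩
  · have : a ≠ b := by rintro rfl; simp_all
    simp [this, ha]
  · have : a ≠ b := by rintro rfl; simp_all [Place.thread?]
    simpa [this] using hs

/-- The application may write into a block in use. -/
lemma GInv.store (G : GInv h live γ) {a x w : ℕ} (ha : a ∈ live) (h1 : a ≤ x)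
    (h2 : x < a + h.blockSize (sbOf a)) :
    GInv { h with mem := Function.update h.mem x w } live γ ∧
      ∀ t', Stable t' h γ { h with mem := Function.update h.mem x w } γ := by
  -- Of the memory words, the invariants read only the first words of small blocks not in use. The
  -- store misses these: blocks of one superblock are disjoint, and the superblocks of a large block
  -- contain no small ones.
  have key : ∀ b c, SBlock γ c b → γ.place b ≠ .live → b ≠ x := by
    rintro b c ⟨⟨st, hs⟩, hb⟩ hl rfl
    obtain ⟨ha1, ⟨c', ⟨st', hs'⟩, ha2⟩ | ⟨ha2, ha3⟩⟩ := G.live_block a ha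
    · rw [(G.small _ _ _ hs').blockSize_eq] at h2
      have e := ha2.sbOf_eq_of_lt h1 h2
      rw [e, hs'] at hs
      cases hs
      exact hl (ha2.eq_of_overlap hb e.symm h1 h2 ▸ ha1)
    · obtain ⟨-, m, hm, hm1, hm2⟩ := G.large _ _ ha2
      rw [hm1] at h2
      have := (hm2 (sbOf b)).2 ⟨Nat.div_le_div_right h1, by
        rw [ha3, ← Nat.add_mul] at h2
        exact (Nat.div_lt_iff_lt_mul sbWords_pos).2 h2⟩
      simp [hs] at this
  refine ⟨⟨G.unused, G.free_linked, G.free_nodup, G.mem_free, G.part_linked, G.part_nodup,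
    G.mem_part, fun d c st e => (G.small d c st e).frame rfl rfl rfl fun b hb e1 e2 => ?_,
    G.large, G.live_block⟩, fun t' => ⟨by simp, by simp, fun b c hb hs => ?_,
      by simp +contextual, by simp, by simp⟩⟩
  · have := key b c ⟨⟨st, e1 ▸ e⟩, e2⟩ (by simp [hb])
    simp [this, hb]
  · have := key b c hs (by rintro e; simp [e, Place.thread?] at hb)
    simpa [this] using hs

/-- A thread may write the fields of a descriptor that it owns. -/
lemma GInv.writeExcl (G : GInv h live γ) {d : ℕ} (hd : γ.own d = .excl t)
    (x : Option cfg.Cls) (y : ℕ) (z : Option ℕ) :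
    Trans t live h γ { h with
      sizeClass := Function.update h.sizeClass d x
      blockSize := Function.update h.blockSize d y
      nextFree := Function.update h.nextFree d z } γ := by
  refine ⟨⟨G.unused, G.free_linked.congr fun e he => ?_, G.free_nodup, G.mem_free,
    G.part_linked, G.part_nodup, G.mem_part,
    fun d' c st e => ?_, fun d' e he => ?_, G.live_block⟩,
    fun t' ne => ⟨fun d' e => ?_, by simp, by simp +contextual, fun a ha hs => ?_, .inr ?_,
      by simp⟩⟩
  · have := G.mem_free e he
    have : e ≠ d := by rintro rfl; simp_all
    simp [this]
  · have : d' ≠ d := by rintro rfl; simp_all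
    exact (G.small d' c st e).frame (by simp [this]) (by simp [this]) rfl
      fun a h1 _ _ => ⟨h1, rfl⟩
  · have h1 := G.large d' e he
    have : e ≠ d := by rintro rfl; simp [h1.own_self] at hd
    simpa [LargeInv, this] using h1
  · have : d' ≠ d := by rintro rfl; simp_all
    simp [this, e]
  · have : sbOf a ≠ d := by rintro e; simp [LBlock, e, hd] at hs
    simp [this, ha, hs]
  · refine ⟨rfl, fun e he => ?_⟩
    have := G.own_free_ptr he
    have : e ≠ d := by rintro rfl; simp_all
    simp [this]

/-- A case of `writeExcl`, in which the other two fields are overwritten with their current values.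
-/
lemma GInv.writeSizeClass (G : GInv h live γ) {d : ℕ} (hd : γ.own d = .excl t)
    (x : Option cfg.Cls) :
    Trans t live h γ { h with sizeClass := Function.update h.sizeClass d x } γ := by
  simpa using G.writeExcl hd x (h.blockSize d) (h.nextFree d)

lemma GInv.writeBlockSize (G : GInv h live γ) {d : ℕ} (hd : γ.own d = .excl t) (y : ℕ) :
    Trans t live h γ { h with blockSize := Function.update h.blockSize d y } γ := by
  simpa using G.writeExcl hd (h.sizeClass d) y (h.nextFree d)

lemma GInv.writeNextFree (G : GInv h live γ) {d : ℕ} (hd : γ.own d = .excl t) (z : Option ℕ) :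
    Trans t live h γ { h with nextFree := Function.update h.nextFree d z } γ := by
  simpa using G.writeExcl hd (h.sizeClass d) (h.blockSize d) z

/-- The invariant reads anchors only of superblocks divided into small blocks; any other anchor may
be set freely. -/
lemma GInv.writeAnchor (G : GInv h live γ) {d : ℕ} (hd : ∀ c st, γ.own d ≠ .small c st)
    (x : Anchor) : Trans t live h γ { h with anchor := Function.update h.anchor d x } γ := by
  refine ⟨⟨G.unused, G.free_linked, G.free_nodup, G.mem_free,
    G.part_linked, G.part_nodup, G.mem_part,
    fun d' c st e => ?_, G.large, G.live_block⟩,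
    fun t' ne => ⟨by simp, by simp, by simp +contextual, by simp +contextual, by simp,
      by simp⟩⟩
  have : d' ≠ d := by rintro rfl; exact hd c st e
  exact (G.small d' c st e).frame rfl rfl (by simp [this]) fun a h1 _ _ => ⟨h1, rfl⟩

/-- A thread may write the list pointer of a superblock that it is about to push to the partial
list. -/
lemma GInv.writeNextPartial (G : GInv h live γ) {d : ℕ} {c : cfg.Cls}
    (hd : γ.own d = .small c (.held t)) (z : Option ℕ) :
    Trans t live h γ { h with nextPartial := Function.update h.nextPartial d z } γ := by
  refine ⟨⟨G.unused, G.free_linked, G.free_nodup, G.mem_free,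
    fun c => (G.part_linked c).congr fun e he => ?_, G.part_nodup, G.mem_part,
    fun d' c st e => (G.small d' c st e).frame rfl rfl rfl fun a h1 _ _ => ⟨h1, rfl⟩,
    G.large, G.live_block⟩,
    fun t' ne => ⟨by simp, fun d' c' e => ?_, by simp +contextual, by simp +contextual, by simp,
      fun c => .inr ⟨rfl, fun e he => ?_⟩⟩⟩
  · have := G.mem_part c e he
    have : e ≠ d := by rintro rfl; simp_all
    simp [this]
  · have : d' ≠ d := by rintro rfl; simp_all
    simp [this, e]
  · have := G.own_part_ptr he
    have : e ≠ d := by rintro rfl; simp_all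
    simp [this]

/-! ### Pushing to and popping from the partial lists -/

/-- The superblock `d` changes its role with respect to the partial list. -/
def Ghost.setStatus (γ : Ghost cfg T) (d : ℕ) (c : cfg.Cls) (st : Status T) : Ghost cfg T :=
  { γ with own := fun x => if x = d then .small c st else γ.own x }

/-- Being a block depends on the class of the superblock, not on its status, and the class stays the
same here. -/
lemma sblock_setStatus {c c' : cfg.Cls} {d a : ℕ} {st st' : Status T}
    (hd : γ.own d = .small c st) :
    SBlock (γ.setStatus d c st') c' a ↔ SBlock γ c' a := by
  unfold SBlock Ghost.setStatus
  by_cases e : sbOf a = d <;> simp [e, hd]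

lemma lblock_setStatus {c : cfg.Cls} {d a : ℕ} {st st' : Status T}
    (hd : γ.own d = .small c st) :
    LBlock (γ.setStatus d c st') a ↔ LBlock γ a := by
  unfold LBlock Ghost.setStatus
  by_cases e : sbOf a = d <;> simp [e, hd]

lemma own_setStatus_large {c : cfg.Cls} {d x e : ℕ} {st st' : Status T}
    (hd : γ.own d = .small c st) :
    (γ.setStatus d c st').own x = .large e ↔ γ.own x = .large e := by
  unfold Ghost.setStatus
  by_cases e : x = d <;> simp [e, hd]

lemma largeInv_setStatus {c : cfg.Cls} {d e : ℕ} {st st' : Status T}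
    (hd : γ.own d = .small c st) :
    LargeInv h (γ.setStatus d c st') e ↔ LargeInv h γ e := by
  unfold LargeInv
  simp only [own_setStatus_large hd]

lemma keep_setStatus {c : cfg.Cls} {d : ℕ} {st st' : Status T} (hd : γ.own d = .small c st) :
    Keep t γ (γ.setStatus d c st') :=
  fun _ _ _ b => ⟨rfl, (sblock_setStatus hd).2 b⟩

/-- A thread pops a superblock from the partial list. -/
lemma GInv.popPartial (G : GInv h live γ) {d : ℕ} {c : cfg.Cls} {next : Option ℕ}
    (e : (h.partialHead c).ptr = some d) (en : h.nextPartial d = next) :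
    Trans t live h γ
      { h with partialHead := Function.update h.partialHead c ⟨next, (h.partialHead c).ctr + 1⟩ }
      { γ.setStatus d c (.held t) with partL := Function.update γ.partL c (γ.partL c).tail } ∧
    (γ.partL c).length = (γ.partL c).tail.length + 1 := by
  obtain ⟨M, e1, e2⟩ := G.partL_of_ptr e
  have hd := G.own_part_ptr e
  have hn := G.part_nodup c
  rw [e1] at hn
  refine ⟨⟨⟨fun x hx => ?_, G.free_linked, G.free_nodup, fun x hx => ?_, fun c' => ?_, fun c' => ?_,
    fun c' x hx => ?_, fun x c' st hx => ?_,
    fun x e hx => (largeInv_setStatus hd).2 (G.large x e ((own_setStatus_large hd).1 hx)),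
    fun a ha => ?_⟩,
    fun t' ne => ⟨fun x hx => ?_, fun x c' hx => ?_, fun a c' h1 h2 =>
      ⟨rfl, (sblock_setStatus hd).2 h2, rfl⟩,
      fun a h1 h2 => ⟨h1, (lblock_setStatus hd).2 h2, rfl⟩, by simp, fun c' => ?_⟩⟩, ?_⟩
  · have := G.unused x hx
    have : x ≠ d := by rintro rfl; simp_all
    simp [Ghost.setStatus, *]
  · have := G.mem_free x hx
    have : x ≠ d := by rintro rfl; simp_all
    simp [Ghost.setStatus, *]
  · by_cases hc : c' = c
    · subst hc; simpa [e1, ← en] using e2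
    · simpa [hc] using G.part_linked c'
  · by_cases hc : c' = c
    · subst hc; simpa [e1] using hn.tail
    · simpa [hc] using G.part_nodup c'
  · by_cases hc : c' = c
    · subst hc
      simp only [Function.update_self, e1, List.tail_cons] at hx
      have : x ≠ d := by rintro rfl; simp_all
      have := G.mem_part c' x (by simp [e1, hx])
      simp [Ghost.setStatus, *]
    · simp only [Function.update_of_ne hc] at hx
      have := G.mem_part c' x hx
      have : x ≠ d := by rintro rfl; simp_all
      simp [Ghost.setStatus, *]
  · by_cases hxd : x = d
    · subst hxd
      simp only [Ghost.setStatus, if_true, Own.small.injEq] at hx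
      obtain ⟨rfl, rfl⟩ := hx
      obtain ⟨i1, i2, i3, i4, i5⟩ := G.small x c _ hd
      exact ⟨i1, i2, i3, by simpa using i4, i5⟩
    · simp only [Ghost.setStatus, if_neg hxd] at hx
      exact (G.small x c' st hx).frame rfl rfl rfl fun a h1 _ _ => ⟨h1, rfl⟩
  · obtain ⟨h1, h2⟩ := G.live_block a ha
    exact ⟨h1, h2.imp (fun ⟨c', h⟩ => ⟨c', (sblock_setStatus hd).2 h⟩)
      (fun h => (lblock_setStatus hd).2 h)⟩
  · have : x ≠ d := by rintro rfl; simp_all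
    simp [Ghost.setStatus, *]
  · have : x ≠ d := by rintro rfl; simp_all
    simp [Ghost.setStatus, *]
  · by_cases hc : c' = c
    · subst hc; simp
    · simp [hc]
  · simp [e1]

/-- A thread pushes a superblock to the partial list. -/
lemma GInv.pushPartial (G : GInv h live γ) {d : ℕ} {c : cfg.Cls}
    (hd : γ.own d = .small c (.held t)) (en : h.nextPartial d = (h.partialHead c).ptr) :
    Trans t live h γ
      { h with
        partialHead := Function.update h.partialHead c ⟨some d, (h.partialHead c).ctr + 1⟩ }
      { γ.setStatus d c .listed with partL := Function.update γ.partL c (d :: γ.partL c) } := by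
  refine ⟨⟨fun x hx => ?_, G.free_linked, G.free_nodup, fun x hx => ?_, fun c' => ?_, fun c' => ?_,
    fun c' x hx => ?_, fun x c' st hx => ?_,
    fun x e hx => (largeInv_setStatus hd).2 (G.large x e ((own_setStatus_large hd).1 hx)),
    fun a ha => ?_⟩,
    fun t' ne => ⟨fun x hx => ?_, fun x c' hx => ?_, fun a c' h1 h2 =>
      ⟨rfl, (sblock_setStatus hd).2 h2, rfl⟩,
      fun a h1 h2 => ⟨h1, (lblock_setStatus hd).2 h2, rfl⟩, by simp, fun c' => ?_⟩⟩
  · have := G.unused x hx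
    have : x ≠ d := by rintro rfl; simp_all
    simp [Ghost.setStatus, *]
  · have := G.mem_free x hx
    have : x ≠ d := by rintro rfl; simp_all
    simp [Ghost.setStatus, *]
  · by_cases hc : c' = c
    · subst hc; simpa [Linked, en] using G.part_linked c'
    · simpa [hc] using G.part_linked c'
  · by_cases hc : c' = c
    · subst hc
      -- Listed superblocks have status `listed`, but this one is still held, so the push creates no
      -- repetition.
      have : d ∉ γ.partL c' := fun hm => by have := G.mem_part c' d hm; simp_all
      simpa [this] using G.part_nodup c'
    · simpa [hc] using G.part_nodup c'
  · by_cases hxd : x = d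
    · subst hxd
      by_cases hc : c' = c
      · subst hc; simp [Ghost.setStatus]
      · simp only [Function.update_of_ne hc] at hx
        have := G.mem_part c' x hx
        simp_all
    · have : x ∈ γ.partL c' := by
        by_cases hc : c' = c
        · subst hc; simpa [hxd] using hx
        · simpa [hc] using hx
      simpa [Ghost.setStatus, hxd] using G.mem_part c' x this
  · by_cases hxd : x = d
    · subst hxd
      simp only [Ghost.setStatus, if_true, Own.small.injEq] at hx
      obtain ⟨rfl, rfl⟩ := hx
      obtain ⟨i1, i2, i3, i4, i5⟩ := G.small x c _ hd
      exact ⟨i1, i2, i3, by simpa using i4, i5⟩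
    · simp only [Ghost.setStatus, if_neg hxd] at hx
      exact (G.small x c' st hx).frame rfl rfl rfl fun a h1 _ _ => ⟨h1, rfl⟩
  · obtain ⟨h1, h2⟩ := G.live_block a ha
    exact ⟨h1, h2.imp (fun ⟨c', h⟩ => ⟨c', (sblock_setStatus hd).2 h⟩)
      (fun h => (lblock_setStatus hd).2 h)⟩
  · have : x ≠ d := by rintro rfl; simp_all
    simp [Ghost.setStatus, *]
  · have : x ≠ d := by rintro rfl; simp_all
    simp [Ghost.setStatus, *]
  · by_cases hc : c' = c
    · subst hc; simp
    · simp [hc]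

end

/-! ### Transfers of whole superblocks and chains of blocks -/

section
variable {t : T} {live : Set ℕ} {h : Heap cfg} {γ : Ghost cfg T}

/-- The superblocks `u, …, v - 1` get the owner `o`. -/
def Ghost.setOwn (γ : Ghost cfg T) (u v : ℕ) (o : Own cfg T) : Ghost cfg T :=
  { γ with own := fun x => if u ≤ x ∧ x < v then o else γ.own x }

/-- The superblock is neither in use for blocks nor owned by a thread other than `t`. -/
def Own.Inert (t : T) : Own cfg T → Prop
  | .unused => True
  | .free => True
  | .excl t' => t' = t
  | _ => False

lemma own_setOwn_of_mem {u v x : ℕ} {o : Own cfg T} (h1 : u ≤ x) (h2 : x < v) :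
    (γ.setOwn u v o).own x = o := if_pos ⟨h1, h2⟩

lemma own_setOwn_of_not_mem {u v x : ℕ} {o : Own cfg T} (h : ¬ (u ≤ x ∧ x < v)) :
    (γ.setOwn u v o).own x = γ.own x := if_neg h

lemma not_mem_of_own {u v x : ℕ} (i : ∀ x, u ≤ x → x < v → (γ.own x).Inert t)
    (h : ¬ (γ.own x).Inert t) : ¬ (u ≤ x ∧ x < v) := fun ⟨h1, h2⟩ => h (i x h1 h2)

/-- Neither the old owners in the range nor the new one is of the form `small`, so the exchange is
invisible to small blocks. -/
lemma own_setOwn_small {u v x : ℕ} {o : Own cfg T} {c : cfg.Cls} {st : Status T}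
    (i : ∀ x, u ≤ x → x < v → (γ.own x).Inert t) (io : o.Inert t) :
    (γ.setOwn u v o).own x = .small c st ↔ γ.own x = .small c st := by
  by_cases e : u ≤ x ∧ x < v
  · have := i x e.1 e.2
    rw [own_setOwn_of_mem e.1 e.2]
    constructor <;> rintro h <;> simp_all [Own.Inert]
  · rw [own_setOwn_of_not_mem e]

lemma own_setOwn_large {u v x e : ℕ} {o : Own cfg T}
    (i : ∀ x, u ≤ x → x < v → (γ.own x).Inert t) (io : o.Inert t) :
    (γ.setOwn u v o).own x = .large e ↔ γ.own x = .large e := by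
  by_cases e : u ≤ x ∧ x < v
  · have := i x e.1 e.2
    rw [own_setOwn_of_mem e.1 e.2]
    constructor <;> rintro h <;> simp_all [Own.Inert]
  · rw [own_setOwn_of_not_mem e]

/-- The parts of the invariant that concern blocks do not depend on the owners of superblocks that
are not in use for blocks. -/
lemma GInv.setOwn (G : GInv h live γ) {h' : Heap cfg} {u v : ℕ} {o : Own cfg T} {L : List ℕ}
    (i : ∀ x, u ≤ x → x < v → (γ.own x).Inert t) (io : o.Inert t)
    (e1 : h'.sizeClass = h.sizeClass) (e2 : h'.blockSize = h.blockSize)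
    (e3 : h'.anchor = h.anchor) (e4 : h'.nextFree = h.nextFree)
    (e5 : h'.nextPartial = h.nextPartial) (e6 : h'.mem = h.mem)
    (e7 : h'.partialHead = h.partialHead)
    (j1 : ∀ d, h'.used ≤ d → (γ.setOwn u v o).own d = .unused)
    (j2 : Linked h.nextFree h'.freeHead.ptr L) (j3 : L.Nodup)
    (j4 : ∀ d ∈ L, (γ.setOwn u v o).own d = .free)
    (j5 : h.freeHead.ctr < h'.freeHead.ctr ∨ h'.freeHead = h.freeHead) :
    Trans t live h γ h' { γ.setOwn u v o with freeL := L } ∧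
      Keep t γ { γ.setOwn u v o with freeL := L } := by
  have hS : ∀ c a, SBlock γ c a → SBlock { γ.setOwn u v o with freeL := L } c a :=
    fun c a ⟨⟨st, b1⟩, b2⟩ => ⟨⟨st, (own_setOwn_small i io).2 b1⟩, b2⟩
  have hL : ∀ a, LBlock γ a → LBlock { γ.setOwn u v o with freeL := L } a :=
    fun a ⟨b1, b2⟩ => ⟨(own_setOwn_large i io).2 b1, b2⟩
  refine ⟨⟨⟨j1, e4 ▸ j2, j3, j4, fun c => ?_, G.part_nodup, fun c d hd =>
    (own_setOwn_small i io).2 (G.mem_part c d hd), fun d c st e => ?_, fun d e he => ?_,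
    fun a ha => ?_⟩, fun t' ne => ⟨fun d e => ?_, fun d c e => ?_, fun a c h1 h2 =>
      ⟨rfl, hS c a h2, by rw [e6]⟩, fun a h1 h2 => ⟨h1, hL a h2, by rw [e2]⟩, ?_, ?_⟩⟩,
    fun a c _ h2 => ⟨rfl, hS c a h2⟩⟩
  · rw [e5, e7]; exact G.part_linked c
  · exact (G.small d c st ((own_setOwn_small i io).1 e)).frame (by rw [e1]) (by rw [e2])
      (by rw [e3]) fun a h1 _ _ => ⟨h1, by rw [e6]⟩
  · have := G.large d e ((own_setOwn_large i io).1 he)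
    unfold LargeInv at this ⊢
    rw [e1, e2]
    exact this.imp id fun ⟨m, h1, h2, h3⟩ =>
      ⟨m, h1, h2, fun x => (own_setOwn_large i io).trans (h3 x)⟩
  · obtain ⟨h1, h2⟩ := G.live_block a ha
    exact ⟨h1, h2.imp (fun ⟨c', h⟩ => ⟨c', hS c' a h⟩) (hL a)⟩
  · have : ¬ (u ≤ d ∧ d < v) := not_mem_of_own i (by simpa [e, Own.Inert] using ne)
    simp only [e1, e2, e4, and_true]
    exact (own_setOwn_of_not_mem this).trans e
  · exact ⟨(own_setOwn_small i io).2 e, by rw [e5]⟩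
  · exact j5.imp id fun e => ⟨e, by simp [e4]⟩
  · exact fun c => .inr ⟨by rw [e7], by simp [e5]⟩

/-- A thread pops a superblock from the superblock free list. -/
lemma GInv.popFree (G : GInv h live γ) (t : T) {d : ℕ} {next : Option ℕ}
    (e : h.freeHead.ptr = some d) (en : h.nextFree d = next) :
    Trans t live h γ { h with freeHead := ⟨next, h.freeHead.ctr + 1⟩ }
      { γ.setOwn d (d + 1) (.excl t) with freeL := γ.freeL.tail } ∧
    Keep t γ { γ.setOwn d (d + 1) (.excl t) with freeL := γ.freeL.tail } := by
  obtain ⟨M, e1, e2⟩ := G.freeL_of_ptr e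
  have hd := G.own_free_ptr e
  have hn := G.free_nodup
  rw [e1] at hn
  refine G.setOwn (fun x h1 h2 => ?_) rfl rfl rfl rfl rfl rfl rfl rfl (fun x hx => ?_) ?_ ?_
    (fun x hx => ?_) (.inl (by simp))
  · obtain rfl : x = d := by omega
    simp [hd, Own.Inert]
  · have := G.unused x hx
    have : x ≠ d := by rintro rfl; simp_all
    rw [own_setOwn_of_not_mem (by omega)]
    assumption
  · simpa [e1, ← en] using e2
  · simpa [e1] using hn.tail
  · simp only [e1, List.tail_cons] at hx
    have : x ≠ d := by rintro rfl; simp_all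
    rw [own_setOwn_of_not_mem (by omega)]
    exact G.mem_free x (by simp [e1, hx])

/-- A thread extends the used prefix. -/
lemma GInv.extend (G : GInv h live γ) (t : T) {v : ℕ} (hv : h.used ≤ v) :
    Trans t live h γ { h with used := v } (γ.setOwn h.used v (.excl t)) ∧
    Keep t γ (γ.setOwn h.used v (.excl t)) := by
  refine G.setOwn (L := γ.freeL) (fun x h1 h2 => ?_) rfl rfl rfl rfl rfl rfl rfl rfl
    (fun x hx => ?_) G.free_linked G.free_nodup (fun x hx => ?_) (.inr rfl)
  · simp [G.unused x h1, Own.Inert]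
  · rw [own_setOwn_of_not_mem (by simp at hx; omega)]
    exact G.unused x (hv.trans hx)
  · have := G.mem_free x hx
    rw [own_setOwn_of_not_mem, this]
    rintro ⟨h1, -⟩
    simp [G.unused x h1] at this

/-- Describes the free list after a push: the superblocks of a pushed chain are consecutive, and the
last one points to the former head. -/
lemma Linked.append_range {next : ℕ → Option ℕ} {f n : ℕ} {L : List ℕ} {o : Option ℕ}
    (h1 : ∀ j, f ≤ j → j < f + n → next j = some (j + 1)) (h2 : next (f + n) = o)
    (hL : Linked next o L) : Linked next (some f) (List.range' f (n + 1) ++ L) := by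
  induction n generalizing f with
  | zero => exact ⟨rfl, by subst h2; exact hL⟩
  | succ n ih =>
    rw [List.range'_succ]
    refine ⟨rfl, ?_⟩
    rw [h1 f le_rfl (by omega)]
    refine ih (fun j hj hj' => h1 j (by omega) (by omega)) ?_
    rw [← h2]
    congr 1
    omega

/-- A thread pushes a chain of superblocks to the superblock free list. -/
lemma GInv.pushFree (G : GInv h live γ) {f l : ℕ} (i : LinkInv h γ t f l l)
    (e : h.nextFree l = h.freeHead.ptr) : ∃ γ',
    Trans t live h γ { h with freeHead := ⟨some f, h.freeHead.ctr + 1⟩ } γ' ∧ Keep t γ γ' ∧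
      γ'.partL = γ.partL := by
  obtain ⟨i1, -, i3, i4⟩ := i
  obtain ⟨n, rfl⟩ := Nat.exists_eq_add_of_le i1
  have key := G.setOwn (t := t) (h' := { h with freeHead := ⟨some f, h.freeHead.ctr + 1⟩ })
    (u := f) (v := f + n + 1) (o := .free) (L := List.range' f (n + 1) ++ γ.freeL)
    (fun x h1 h2 => by simp [i3 x h1 h2, Own.Inert]) trivial rfl rfl rfl rfl rfl rfl rfl
    (fun x hx => ?_) ?_ ?_ (fun x hx => ?_) (.inl (by simp))
  · exact ⟨_, key.1, key.2, rfl⟩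
  · have := G.unused x hx
    rw [own_setOwn_of_not_mem, this]
    rintro ⟨h1, h2⟩
    simp [i3 x h1 h2] at this
  · exact Linked.append_range i4 e G.free_linked
  · refine List.Nodup.append (List.nodup_range' (step := 1)) G.free_nodup fun x h1 h2 => ?_
    have := G.mem_free x h2
    rw [List.mem_range'_1] at h1
    simp [i3 x h1.1 (by omega)] at this
  · rw [List.mem_append, List.mem_range'_1] at hx
    by_cases hc : f ≤ x ∧ x < f + n + 1
    · exact own_setOwn_of_mem hc.1 hc.2
    · rw [own_setOwn_of_not_mem hc]
      exact G.mem_free x (hx.resolve_left (by omega))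

/-- A superblock all of whose blocks are free becomes available for other purposes. -/
lemma GInv.retire (G : GInv h live γ) {c : cfg.Cls} {d : ℕ} (hd : γ.own d = .small c (.held t))
    (he : (h.anchor d).state = .EMPTY) :
    Trans t live h γ h (γ.setOwn d (d + 1) (.excl t)) ∧
      Keep t γ (γ.setOwn d (d + 1) (.excl t)) := by
  have hne : ∀ x, x ≠ d → (γ.setOwn d (d + 1) (.excl t)).own x = γ.own x :=
    fun x hx => own_setOwn_of_not_mem (by omega)
  have hself : (γ.setOwn d (d + 1) (.excl t)).own d = .excl t :=
    own_setOwn_of_mem le_rfl (by omega)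
  -- A block that is in use or held by a thread cannot lie in `d`, whose blocks are all on its free
  -- list.
  have hS : ∀ a c, γ.place a ≠ .chain → SBlock γ c a →
      SBlock (γ.setOwn d (d + 1) (.excl t)) c a := by
    rintro a c' hp ⟨⟨st, b1⟩, b2⟩
    have : sbOf a ≠ d := by
      intro e
      rw [e, hd] at b1
      cases b1
      exact hp ((G.small d c _ hd).place_of_empty he e b2)
    exact ⟨⟨st, (hne _ this).trans b1⟩, b2⟩
  have hlarge : ∀ x e, (γ.setOwn d (d + 1) (.excl t)).own x = .large e ↔ γ.own x = .large e := by
    intro x e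
    by_cases hx : x = d
    · simp [hx, hself, hd]
    · rw [hne x hx]
  refine ⟨⟨⟨fun x hx => ?_, G.free_linked, G.free_nodup, fun x hx => ?_, G.part_linked,
    G.part_nodup, fun c' x hx => ?_, fun x c' st hx => ?_, fun x e hx => ?_, fun a ha => ?_⟩,
    fun t' ne => ⟨fun x hx => ?_, fun x c' hx => ?_, fun a c' h1 h2 => ⟨rfl, hS a c' ?_ h2, rfl⟩,
      fun a h1 h2 => ⟨h1, ⟨(hlarge _ _).2 h2.1, h2.2⟩, rfl⟩, by simp, by simp⟩⟩,
    fun a c' h1 h2 => ⟨rfl, hS a c' ?_ h2⟩⟩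
  · have := G.unused x hx
    rwa [hne]
    rintro rfl; simp_all
  · have := G.mem_free x hx
    rwa [hne]
    rintro rfl; simp_all
  · have := G.mem_part c' x hx
    rwa [hne]
    rintro rfl; simp_all
  · have hxd : x ≠ d := by rintro rfl; simp [hself] at hx
    rw [hne x hxd] at hx
    exact (G.small x c' st hx).frame rfl rfl rfl fun a h1 _ _ => ⟨h1, rfl⟩
  · have := G.large x e ((hlarge x e).1 hx)
    unfold LargeInv at this ⊢
    simpa only [hlarge] using this
  · obtain ⟨h1, h2⟩ := G.live_block a ha
    exact ⟨h1, h2.imp (fun ⟨c', h⟩ => ⟨c', hS a c' (by simp [h1]) h⟩)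
      fun h => ⟨(hlarge _ _).2 h.1, h.2⟩⟩
  · simp only [and_self, and_true]
    rwa [hne]
    rintro rfl; simp_all
  · simp only [and_true]
    rwa [hne]
    rintro rfl; simp_all
  · rintro e; simp [e, Place.thread?] at h1
  · rintro e; simp [e] at h1

/-- The superblocks of a large block that is being freed become available for other purposes. -/
lemma GInv.freeLarge (G : GInv h live γ) {d m : ℕ} (hd : LargeParam γ t (d * sbWords))
    (hm : h.blockSize d = m * sbWords) :
    Trans t live h γ h (γ.setOwn d (d + m) (.excl t)) ∧ 0 < m := by
  obtain ⟨hp, ho, -⟩ := hd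
  rw [sbOf_mul] at ho
  obtain ⟨-, m', hm', hm2, hr⟩ := G.large d d ho
  obtain rfl : m = m' := Nat.eq_of_mul_eq_mul_right sbWords_pos (hm.symm.trans hm2)
  have hne : ∀ x, γ.own x ≠ .large d → (γ.setOwn d (d + m) (.excl t)).own x = γ.own x :=
    fun x hx => own_setOwn_of_not_mem fun h => hx ((hr x).2 h)
  have hself : ∀ x, γ.own x = .large d → (γ.setOwn d (d + m) (.excl t)).own x = .excl t :=
    fun x hx => own_setOwn_of_mem ((hr x).1 hx).1 ((hr x).1 hx).2
  have hS : ∀ a c, SBlock γ c a → SBlock (γ.setOwn d (d + m) (.excl t)) c a := by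
    rintro a c' ⟨⟨st, b1⟩, b2⟩
    exact ⟨⟨st, (hne _ (by simp [b1])).trans b1⟩, b2⟩
  -- The only large block that disappears is the one at `d * sbWords`, which is held by `t`.
  have hL : ∀ a, γ.place a ≠ .param t → LBlock γ a →
      LBlock (γ.setOwn d (d + m) (.excl t)) a := by
    rintro a hpa ⟨b1, b2⟩
    refine ⟨(hne _ fun e => ?_).trans b1, b2⟩
    rw [b1] at e
    cases e
    rw [← b2] at hp
    exact hpa hp
  have hlarge : ∀ x e, e ≠ d →
      ((γ.setOwn d (d + m) (.excl t)).own x = .large e ↔ γ.own x = .large e) := by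
    intro x e he
    by_cases hx : γ.own x = .large d
    · simp [hx, hself, he.symm]
    · rw [hne x hx]
  refine ⟨⟨⟨fun x hx => ?_, G.free_linked, G.free_nodup, fun x hx => ?_, G.part_linked,
    G.part_nodup, fun c' x hx => ?_, fun x c' st hx => ?_, fun x e hx => ?_, fun a ha => ?_⟩,
    fun t' ne => ⟨fun x hx => ?_, fun x c' hx => ?_, fun a c' h1 h2 => ⟨rfl, hS a c' h2, rfl⟩,
      fun a h1 h2 => ⟨h1, hL a (by simp [h1, ne]) h2, rfl⟩, by simp, by simp⟩⟩, hm'⟩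
  · have := G.unused x hx
    rwa [hne]
    simp [this]
  · have := G.mem_free x hx
    rwa [hne]
    simp [this]
  · have := G.mem_part c' x hx
    rwa [hne]
    simp [this]
  · have hxd : γ.own x ≠ .large d := fun e => by simp [hself x e] at hx
    rw [hne x hxd] at hx
    exact (G.small x c' st hx).frame rfl rfl rfl fun a h1 _ _ => ⟨h1, rfl⟩
  · have he : e ≠ d := by
      rintro rfl
      by_cases hxd : γ.own x = .large e
      · simp [hself x hxd] at hx
      · exact hxd (hne x hxd ▸ hx)
    have := G.large x e ((hlarge x e he).1 hx)
    unfold LargeInv at this ⊢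
    simpa only [hlarge _ e he] using this
  · obtain ⟨h1, h2⟩ := G.live_block a ha
    exact ⟨h1, h2.imp (fun ⟨c', h⟩ => ⟨c', hS a c' h⟩) (hL a (by simp [h1]))⟩
  · simp only [and_self, and_true]
    rwa [hne]
    simp [hx]
  · simp only [and_true]
    rwa [hne]
    simp [hx]

/-- A thread turns superblocks that it owns into a large block. -/
lemma GInv.makeLarge (G : GInv h live γ) {u m : ℕ} (i : Range γ t u (u + m)) (hm : 0 < m)
    (e1 : h.sizeClass u = none) (e2 : h.blockSize u = m * sbWords) : ∃ γ',
    Trans t live h γ h γ' ∧ LargeParam γ' t (u * sbWords) ∧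
      (∀ q, CacheInv γ t q → CacheInv γ' t q) ∧ γ'.partL = γ.partL := by
  -- The new ghost state is made opaque. The facts below describe it completely enough for what
  -- follows, and then its definition is discarded.
  obtain ⟨γ', hγ'⟩ : ∃ γ' : Ghost cfg T, γ' = { γ.setOwn u (u + m) (.large u) with
    place := Function.update γ.place (u * sbWords) (.param t) } := ⟨_, rfl⟩
  have hu : γ.own u = .excl t := i u le_rfl (by omega)
  have hmem : ∀ x, γ.own x ≠ .excl t → γ'.own x = γ.own x := fun x hx => by
    rw [hγ']; exact own_setOwn_of_not_mem fun h => hx (i x h.1 h.2)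
  have hin : ∀ x, u ≤ x → x < u + m → γ'.own x = .large u := fun x h1 h2 => by
    rw [hγ']; exact own_setOwn_of_mem h1 h2
  have hout : ∀ x, ¬ (u ≤ x ∧ x < u + m) → γ'.own x = γ.own x := fun x h => by
    rw [hγ']; exact own_setOwn_of_not_mem h
  -- No stale superblock elsewhere can claim to belong to a large block at `u`, for then `u` itself
  -- would be part of that block.
  have hnl : ∀ x, γ.own x ≠ .large u := fun x hx => by
    have := (G.large x u hx).own_self
    simp [hu] at this
  have hpl : ∀ a, γ.own (sbOf a) ≠ .excl t → γ'.place a = γ.place a := fun a ha => by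
    rw [hγ']
    refine Function.update_of_ne ?_ _ _
    rintro rfl
    rw [sbOf_mul] at ha
    exact ha hu
  have hS : ∀ a c, SBlock γ c a → γ'.place a = γ.place a ∧ SBlock γ' c a := by
    rintro a c' ⟨⟨st, b1⟩, b2⟩
    exact ⟨hpl a (by simp [b1]), ⟨st, (hmem _ (by simp [b1])).trans b1⟩, b2⟩
  have hL : ∀ a, LBlock γ a → γ'.place a = γ.place a ∧ LBlock γ' a := by
    rintro a ⟨b1, b2⟩
    exact ⟨hpl a (by simp [b1]), (hmem _ (by simp [b1])).trans b1, b2⟩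
  have hsmall : ∀ x c st, γ'.own x = .small c st → γ.own x = .small c st := fun x c st hx => by
    by_cases h : u ≤ x ∧ x < u + m
    · simp [hin x h.1 h.2] at hx
    · rwa [hout x h] at hx
  have hlarge : ∀ x e, e ≠ u → (γ'.own x = .large e ↔ γ.own x = .large e) := by
    intro x e he
    by_cases h : u ≤ x ∧ x < u + m
    · simp [hin x h.1 h.2, i x h.1 h.2, he.symm]
    · rw [hout x h]
  have hpart : γ'.partL = γ.partL := by rw [hγ']; rfl
  have hfree : γ'.freeL = γ.freeL := by rw [hγ']; rfl
  have hpu : γ'.place (u * sbWords) = .param t := by rw [hγ']; exact Function.update_self ..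
  clear hγ'
  refine ⟨γ', ⟨⟨fun x hx => ?_, hfree ▸ G.free_linked, hfree ▸ G.free_nodup, fun x hx => ?_,
    hpart ▸ G.part_linked, hpart ▸ G.part_nodup, fun c' x hx => ?_, fun x c' st hx => ?_,
    fun x e hx => ?_, fun a ha => ?_⟩,
    fun t' ne => ⟨fun x hx => ?_, fun x c' hx => ?_, fun a c' h1 h2 =>
        ⟨(hS a c' h2).1, (hS a c' h2).2, rfl⟩,
      fun a h1 h2 => ⟨(hL a h2).1.trans h1, (hL a h2).2, rfl⟩, by simp, by simp⟩⟩, ?_,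
      fun q hq c => ⟨(hq c).1, fun a ha => ?_⟩, hpart⟩
  · have := G.unused x hx
    rwa [hmem]
    simp [this]
  · have := G.mem_free x (hfree ▸ hx)
    rwa [hmem]
    simp [this]
  · have := G.mem_part c' x (hpart ▸ hx)
    rwa [hmem]
    simp [this]
  · have hx' := hsmall x c' st hx
    refine (G.small x c' st hx').frame rfl rfl rfl fun a h1 h2 _ => ⟨?_, rfl⟩
    rw [hpl a (by simp [h2, hx']), h1]
  · by_cases he : e = u
    · subst he
      refine ⟨e1, m, hm, e2, fun x => ⟨fun h => ?_, fun h => hin x h.1 h.2⟩⟩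
      by_contra hc
      rw [hout x hc] at h
      exact hnl x h
    · have := G.large x e ((hlarge x e he).1 hx)
      unfold LargeInv at this ⊢
      simpa only [hlarge _ e he] using this
  · obtain ⟨h1, ⟨c', h2⟩ | h2⟩ := G.live_block a ha
    · exact ⟨(hS a c' h2).1.trans h1, .inl ⟨c', (hS a c' h2).2⟩⟩
    · exact ⟨(hL a h2).1.trans h1, .inr (hL a h2).2⟩
  · simp only [and_self, and_true]
    rwa [hmem]
    simp [hx, ne]
  · simp only [and_true]
    rwa [hmem]
    simp [hx]
  · refine ⟨hpu, ?_, by rw [sbOf_mul]⟩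
    rw [sbOf_mul]
    exact hin u le_rfl (by omega)
  · have := (hq c).2 a ha
    have := hS a c this.2
    simp_all

/-- A thread turns a superblock that it owns into blocks and takes all of them. -/
lemma GInv.makeSmall (G : GInv h live γ) {c : cfg.Cls} {d : ℕ} (hd : γ.own d = .excl t)
    (e1 : h.sizeClass d = some c) (e2 : h.blockSize d = cfg.classWords c) : ∃ γ',
    Trans t live h γ { h with anchor := Function.update h.anchor d (fullAnchor cfg c) } γ' ∧
      (∀ q, CacheInv γ t q → CacheInv γ' t (Function.update q c
        ((List.range (cfg.numBlocks c)).map (cfg.blockAddr c d) ++ q c))) ∧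
      γ'.partL = γ.partL := by
  -- All addresses in `d` are relabelled. This takes nothing from anyone, since an exclusively owned
  -- superblock contains no blocks yet.
  obtain ⟨γ', hγ'⟩ : ∃ γ' : Ghost cfg T, γ' = { γ.setOwn d (d + 1) (.small c .full) with
    place := fun a => if sbOf a = d then .cached t c else γ.place a } := ⟨_, rfl⟩
  have hself : γ'.own d = .small c .full := by
    rw [hγ']; exact own_setOwn_of_mem le_rfl (by omega)
  have hmem : ∀ x, x ≠ d → γ'.own x = γ.own x := fun x hx => by
    rw [hγ']; exact own_setOwn_of_not_mem (by omega)
  have hnl : ∀ x e, γ'.own x = .large e ↔ γ.own x = .large e := fun x e => by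
    by_cases hx : x = d
    · simp [hx, hself, hd]
    · rw [hmem x hx]
  have hpl : ∀ a, sbOf a ≠ d → γ'.place a = γ.place a := fun a ha => by
    rw [hγ']; exact if_neg ha
  have hpd : ∀ a, sbOf a = d → γ'.place a = .cached t c := fun a ha => by
    rw [hγ']; exact if_pos ha
  have hS : ∀ a c, SBlock γ c a → γ'.place a = γ.place a ∧ SBlock γ' c a := by
    rintro a c' ⟨⟨st, b1⟩, b2⟩
    have : sbOf a ≠ d := by rintro e; simp [e, hd] at b1
    exact ⟨hpl a this, ⟨st, (hmem _ this).trans b1⟩, b2⟩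
  have hL : ∀ a, LBlock γ a → γ'.place a = γ.place a ∧ LBlock γ' a := by
    rintro a ⟨b1, b2⟩
    have : sbOf a ≠ d := by rintro e; simp [e, hd] at b1
    exact ⟨hpl a this, (hmem _ this).trans b1, b2⟩
  have hpart : γ'.partL = γ.partL := by rw [hγ']; rfl
  have hfree : γ'.freeL = γ.freeL := by rw [hγ']; rfl
  clear hγ'
  refine ⟨γ', ⟨⟨fun x hx => ?_, hfree ▸ G.free_linked, hfree ▸ G.free_nodup, fun x hx => ?_,
    hpart ▸ G.part_linked, hpart ▸ G.part_nodup, fun c' x hx => ?_, fun x c' st hx => ?_,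
    fun x e hx => ?_, fun a ha => ?_⟩,
    fun t' ne => ⟨fun x hx => ?_, fun x c' hx => ?_, fun a c' h1 h2 =>
        ⟨(hS a c' h2).1, (hS a c' h2).2, rfl⟩,
      fun a h1 h2 => ⟨(hL a h2).1.trans h1, (hL a h2).2, rfl⟩, by simp, by simp⟩⟩,
      fun q hq c' => ?_, hpart⟩
  · have := G.unused x hx
    rwa [hmem]
    rintro rfl; simp_all
  · have := G.mem_free x (hfree ▸ hx)
    rwa [hmem]
    rintro rfl; simp_all
  · have := G.mem_part c' x (hpart ▸ hx)
    rwa [hmem]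
    rintro rfl; simp_all
  · by_cases hxd : x = d
    · subst hxd
      rw [hself] at hx
      cases hx
      exact ⟨e1, e2, ⟨[], by simp [fullAnchor, Chained]⟩, by simp [fullAnchor],
        by simp [fullAnchor]⟩
    · rw [hmem x hxd] at hx
      refine (G.small x c' st hx).frame rfl rfl (by simp [hxd]) fun a h1 h2 _ => ⟨?_, rfl⟩
      rw [hpl a (by rwa [h2]), h1]
  · have := G.large x e ((hnl x e).1 hx)
    unfold LargeInv at this ⊢
    simpa only [hnl] using this
  · obtain ⟨h1, ⟨c', h2⟩ | h2⟩ := G.live_block a ha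
    · exact ⟨(hS a c' h2).1.trans h1, .inl ⟨c', (hS a c' h2).2⟩⟩
    · exact ⟨(hL a h2).1.trans h1, .inr (hL a h2).2⟩
  · simp only [and_self, and_true]
    rwa [hmem]
    rintro rfl; simp_all
  · simp only [and_true]
    rwa [hmem]
    rintro rfl; simp_all
  · have hold : ∀ a ∈ q c', γ'.place a = .cached t c' ∧ SBlock γ' c' a := fun a ha => by
      have h1 := (hq c').2 a ha
      have h2 := hS a c' h1.2
      exact ⟨h2.1.trans h1.1, h2.2⟩
    by_cases hc : c' = c
    · subst hc
      simp only [Function.update_self]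
      refine ⟨List.Nodup.append (List.Nodup.map_on ?_ List.nodup_range) (hq c').1 ?_, ?_⟩
      · intro i hi j hj e
        rw [List.mem_range] at hi hj
        rw [← blockIdx_blockAddr (c := c') (d := d) hi, e, blockIdx_blockAddr hj]
      · intro a h1 h2
        obtain ⟨i, hi, rfl⟩ := List.mem_map.1 h1
        rw [List.mem_range] at hi
        obtain ⟨⟨st, b1⟩, -⟩ := ((hq c').2 _ h2).2
        rw [sbOf_blockAddr hi, hd] at b1
        simp at b1
      · intro a ha
        rcases List.mem_append.1 ha with h1 | h1
        · obtain ⟨i, hi, rfl⟩ := List.mem_map.1 h1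
          rw [List.mem_range] at hi
          exact ⟨hpd _ (sbOf_blockAddr hi), ⟨.full, by rw [sbOf_blockAddr hi, hself]⟩,
            isAddr_blockAddr hi⟩
        · exact hold a h1
    · rw [Function.update_of_ne hc]
      exact ⟨(hq c').1, hold⟩

/-- A thread takes all free blocks of a superblock that it has popped from the partial list. -/
lemma GInv.reserve (G : GInv h live γ) {c : cfg.Cls} {d : ℕ}
    (hd : γ.own d = .small c (.held t)) : ∃ γ' L,
    Trans t live h γ { h with anchor := Function.update h.anchor d (fullAnchor cfg c) } γ' ∧
      Keep t γ γ' ∧ Segment h γ' t c (cfg.blockAddr c d (h.anchor d).avail) L ∧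
      L.length = (h.anchor d).count ∧ γ'.partL = γ.partL := by
  have I := G.small d c _ hd
  obtain ⟨L, l1, l2, l3, l4⟩ := I.chain
  obtain ⟨γ', hγ'⟩ : ∃ γ' : Ghost cfg T, γ' = { γ.setStatus d c .full with
    place := fun a => if a ∈ L then .seg t else γ.place a } := ⟨_, rfl⟩
  have hself : γ'.own d = .small c .full := by rw [hγ']; exact if_pos rfl
  have hmem : ∀ x, x ≠ d → γ'.own x = γ.own x := fun x hx => by rw [hγ']; exact if_neg hx
  have hin : ∀ a ∈ L, γ'.place a = .seg t := fun a ha => by rw [hγ']; exact if_pos ha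
  have hpl : ∀ a, a ∉ L → γ'.place a = γ.place a := fun a ha => by rw [hγ']; exact if_neg ha
  have hSB : ∀ a c, SBlock γ' c a ↔ SBlock γ c a := fun a c => by
    rw [hγ']; exact sblock_setStatus hd
  have hLB : ∀ a, LBlock γ' a ↔ LBlock γ a := fun a => by rw [hγ']; exact lblock_setStatus hd
  have hnl : ∀ x e, γ'.own x = .large e ↔ γ.own x = .large e := fun x e => by
    rw [hγ']; exact own_setStatus_large hd
  have hpart : γ'.partL = γ.partL := by rw [hγ']; rfl
  have hfree : γ'.freeL = γ.freeL := by rw [hγ']; rfl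
  -- The reserved blocks were on the free list of `d`, hence not held by any thread and not in use.
  have hp : ∀ a, γ.place a ≠ .chain → γ'.place a = γ.place a :=
    fun a ha => hpl a fun hm => ha (l4 a hm).1
  clear hγ'
  refine ⟨γ', L, ⟨⟨fun x hx => ?_, hfree ▸ G.free_linked, hfree ▸ G.free_nodup, fun x hx => ?_,
    hpart ▸ G.part_linked, hpart ▸ G.part_nodup, fun c' x hx => ?_, fun x c' st hx => ?_,
    fun x e hx => ?_, fun a ha => ?_⟩,
    fun t' ne => ⟨fun x hx => ?_, fun x c' hx => ?_, fun a c' h1 h2 =>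
        ⟨hp a ?_, (hSB a c').2 h2, rfl⟩,
      fun a h1 h2 => ⟨(hp a ?_).trans h1, (hLB a).2 h2, rfl⟩, by simp, by simp⟩⟩,
      fun a c' h1 h2 => ⟨hp a ?_, (hSB a c').2 h2⟩, ⟨l1, l3, fun a ha => ⟨hin a ha, ?_⟩⟩, l2,
      hpart⟩
  · have := G.unused x hx
    rwa [hmem]
    rintro rfl; simp_all
  · have := G.mem_free x (hfree ▸ hx)
    rwa [hmem]
    rintro rfl; simp_all
  · have := G.mem_part c' x (hpart ▸ hx)
    rwa [hmem]
    rintro rfl; simp_all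
  · by_cases hxd : x = d
    · subst hxd
      rw [hself] at hx
      cases hx
      exact ⟨I.1, I.2, ⟨[], by simp [fullAnchor, Chained]⟩, by simp [fullAnchor],
        by simp [fullAnchor]⟩
    · rw [hmem x hxd] at hx
      refine (G.small x c' st hx).frame rfl rfl (by simp [hxd]) fun a h1 h2 _ => ⟨?_, rfl⟩
      rw [hpl a (fun hm => hxd (h2.symm.trans (l4 a hm).2.1)), h1]
  · have := G.large x e ((hnl x e).1 hx)
    unfold LargeInv at this ⊢
    simpa only [hnl] using this
  · obtain ⟨h1, h2⟩ := G.live_block a ha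
    exact ⟨(hp a (by simp [h1])).trans h1, h2.imp (fun ⟨c', h⟩ => ⟨c', (hSB a c').2 h⟩)
      (hLB a).2⟩
  · simp only [and_self, and_true]
    rwa [hmem]
    rintro rfl; simp_all
  · simp only [and_true]
    rwa [hmem]
    rintro rfl; simp_all
  · rintro e; simp [e, Place.thread?] at h1
  · simp [h1]
  · rintro e; simp [e] at h1
  · obtain ⟨h1, h2, h3⟩ := l4 a ha
    exact (hSB a c).2 ⟨⟨_, by rw [h2, hd]⟩, h3⟩

/-- A thread pushes a chain of blocks to the block free list of their superblock. -/
lemma GInv.returnBlocks (G : GInv h live γ) {c : cfg.Cls} {p d head tail n : ℕ}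
    (i : ReturnInv h γ t c p d head tail n)
    (e : h.mem tail = cfg.blockAddr c d (h.anchor d).avail) : ∃ γ',
    Trans t live h γ { h with
      anchor := Function.update h.anchor d (pushAnchor cfg c (h.anchor d) head n) } γ' ∧
      Keep t γ γ' ∧
      ((h.anchor d).state = .FULL → γ'.own d = .small c (.held t)) ∧ γ'.partL = γ.partL := by
  obtain ⟨-, L, ⟨s1, s2, s3⟩, rfl, s4⟩ := i
  obtain ⟨st₀, hd⟩ : ∃ st, γ.own d = .small c st := by
    have := (s3 tail (by simp)).2.1
    rwa [s4 tail (by simp)] at this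
  have I := G.small d c _ hd
  obtain ⟨C, l1, l2, l3, l4⟩ := I.chain
  have hhead : cfg.blockAddr c d (cfg.blockIdx c head) = head := by
    have : head ∈ L ++ [tail] := by
      cases L with
      | nil => simp [s2.1]
      | cons b L => simp [s2.1]
    have h1 := (s3 head this).2.2.blockAddr_blockIdx
    rwa [s4 head this] at h1
  -- The thread that moves a superblock away from FULL becomes responsible for listing or retiring
  -- it. In any other state it is already listed or held, and stays so.
  obtain ⟨st₁, hst⟩ : ∃ st₁ : Status T,
    st₁ = if (h.anchor d).state = .FULL then .held t else st₀ := ⟨_, rfl⟩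
  have hst1 : st₁ ≠ .full := by
    rw [hst]
    split_ifs with hF
    · simp
    · exact fun e => hF (I.full_iff.2 e)
  have hst0 : st₀ ≠ .full → st₁ = st₀ := fun e => by
    rw [hst, if_neg fun hF => e (I.full_iff.1 hF)]
  obtain ⟨γ', hγ'⟩ : ∃ γ' : Ghost cfg T, γ' = { γ.setStatus d c st₁ with
    place := fun a => if a ∈ L ++ [tail] then .chain else γ.place a } := ⟨_, rfl⟩
  have hself : γ'.own d = .small c st₁ := by rw [hγ']; exact if_pos rfl
  have hmem : ∀ x, x ≠ d → γ'.own x = γ.own x := fun x hx => by rw [hγ']; exact if_neg hx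
  have hin : ∀ a ∈ L ++ [tail], γ'.place a = .chain := fun a ha => by rw [hγ']; exact if_pos ha
  have hpl : ∀ a, a ∉ L ++ [tail] → γ'.place a = γ.place a := fun a ha => by
    rw [hγ']; exact if_neg ha
  have hSB : ∀ a c, SBlock γ' c a ↔ SBlock γ c a := fun a c => by
    rw [hγ']; exact sblock_setStatus hd
  have hLB : ∀ a, LBlock γ' a ↔ LBlock γ a := fun a => by rw [hγ']; exact lblock_setStatus hd
  have hnl : ∀ x e, γ'.own x = .large e ↔ γ.own x = .large e := fun x e => by
    rw [hγ']; exact own_setStatus_large hd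
  have hpart : γ'.partL = γ.partL := by rw [hγ']; rfl
  have hfree : γ'.freeL = γ.freeL := by rw [hγ']; rfl
  have hp : ∀ a, γ.place a ≠ .seg t → γ'.place a = γ.place a :=
    fun a ha => hpl a fun hm => ha (s3 a hm).1
  clear hγ'
  refine ⟨γ', ⟨⟨fun x hx => ?_, hfree ▸ G.free_linked, hfree ▸ G.free_nodup, fun x hx => ?_,
    hpart ▸ G.part_linked, hpart ▸ G.part_nodup, fun c' x hx => ?_, fun x c' st hx => ?_,
    fun x e hx => ?_, fun a ha => ?_⟩,
    fun t' ne => ⟨fun x hx => ?_, fun x c' hx => ?_, fun a c' h1 h2 =>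
        ⟨hp a ?_, (hSB a c').2 h2, rfl⟩,
      fun a h1 h2 => ⟨(hp a ?_).trans h1, (hLB a).2 h2, rfl⟩, by simp, by simp⟩⟩,
      fun a c' h1 h2 => ⟨hp a ?_, (hSB a c').2 h2⟩, fun hF => ?_, hpart⟩
  · have := G.unused x hx
    rwa [hmem]
    rintro rfl; simp_all
  · have := G.mem_free x (hfree ▸ hx)
    rwa [hmem]
    rintro rfl; simp_all
  · have h1 := G.mem_part c' x (hpart ▸ hx)
    by_cases hxd : x = d
    · subst hxd
      rw [hd] at h1
      cases h1
      rw [hself, hst0 (by simp)]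
    · rwa [hmem x hxd]
  · by_cases hxd : x = d
    · subst hxd
      rw [hself] at hx
      cases hx
      refine ⟨I.1, I.2, ⟨L ++ [tail] ++ C, ?_, ?_, ?_, ?_⟩, ?_, ?_⟩
      · refine List.Nodup.append s1 l1 fun a h1 h2 => ?_
        have h3 := (s3 a h1).1
        rw [(l4 a h2).1] at h3
        cases h3
      · simp [pushAnchor, l2]
        omega
      · simp only [Function.update_self, pushAnchor, hhead]
        exact s2.append e l3
      · intro a ha
        rcases List.mem_append.1 ha with h1 | h1
        · exact ⟨hin a h1, s4 a h1, (s3 a h1).2.2⟩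
        · obtain ⟨h2, h3⟩ := l4 a h1
          exact ⟨(hp a (by simp [h2])).trans h2, h3⟩
      · simp only [Function.update_self, pushAnchor, hst1, iff_false]
        split_ifs <;> simp
      · simp only [Function.update_self, pushAnchor]
        split_ifs with hc
        · exact fun _ => hc
        · simp
    · rw [hmem x hxd] at hx
      refine (G.small x c' st hx).frame rfl rfl (by simp [hxd]) fun a h1 h2 _ => ⟨?_, rfl⟩
      rw [hp a (by simp [h1]), h1]
  · have := G.large x e ((hnl x e).1 hx)
    unfold LargeInv at this ⊢
    simpa only [hnl] using this
  · obtain ⟨h1, h2⟩ := G.live_block a ha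
    exact ⟨(hp a (by simp [h1])).trans h1, h2.imp (fun ⟨c', h⟩ => ⟨c', (hSB a c').2 h⟩)
      (hLB a).2⟩
  · simp only [and_self, and_true]
    rwa [hmem]
    rintro rfl; simp_all
  · simp only [and_true]
    by_cases hxd : x = d
    · subst hxd
      rw [hd] at hx
      cases hx
      rw [hself, hst0 (by simp)]
    · rwa [hmem x hxd]
  · rintro e; simp [e, Place.thread?, ne.symm] at h1
  · simp [h1]
  · rintro e; simp [e] at h1
  · rw [hself, hst, if_pos hF]

end

/-! ### Preservation of the invariant by steps of the allocator -/

/-- Number of superblocks that the next step pops from a partial list. -/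
def pops (h : Heap cfg) : PC cfg → ℕ
  | .ppCas c old _ _ => if h.partialHead c = old then 1 else 0
  | _ => 0

/-- Number of superblocks that the next step pushes to a partial list. -/
def pushes (h : Heap cfg) : PC cfg → ℕ
  | .qpCas c _ _ old => if h.partialHead c = old then 1 else 0
  | _ => 0

/-- Total length of the partial lists. -/
def Ghost.partLen (γ : Ghost cfg T) : ℕ := ∑ c, (γ.partL c).length

/-- The additive form avoids truncated subtraction and serves pushes and pops alike. -/
lemma sum_length_update (f : cfg.Cls → List ℕ) (c : cfg.Cls) (L : List ℕ) :
    ∑ c', (Function.update f c L c').length + (f c).length =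
      ∑ c', (f c').length + L.length := by
  have h1 := Finset.add_sum_erase Finset.univ (fun c' => (f c').length) (Finset.mem_univ c)
  have h2 := Finset.add_sum_erase Finset.univ (fun c' => (Function.update f c L c').length)
    (Finset.mem_univ c)
  have h3 : ∑ c' ∈ Finset.univ.erase c, (Function.update f c L c').length =
      ∑ c' ∈ Finset.univ.erase c, (f c').length := Finset.sum_congr rfl fun c' hc => by
    rw [Function.update_of_ne (Finset.ne_of_mem_erase hc)]
  simp only [Function.update_self] at h2
  omega

/-- The end of a chain is known from its length, so the first word of the last block is never
followed and may be redirected before the CAS publishes the chain. -/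
lemma Chained.update_last {mem : ℕ → ℕ} {L : List ℕ} {a x w : ℕ} (h : Chained mem a (L ++ [x]))
    (hn : (L ++ [x]).Nodup) : Chained (Function.update mem x w) a (L ++ [x]) := by
  induction L generalizing a with
  | nil => exact ⟨h.1, trivial⟩
  | cons b L ih =>
    obtain ⟨h1, h2⟩ := List.nodup_cons.1 hn
    have : b ≠ x := by rintro rfl; simp at h1
    refine ⟨h.1, ?_⟩
    rw [Function.update_of_ne this]
    exact ih h.2 h2

/-- A request for 0 bytes is served by any class, and there is at least one. Hence a large request
always extends the used prefix strictly. -/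
lemma largeCount_pos {n : ℕ} (e : cfg.classFor n = none) : 0 < largeCount n := by
  have := List.find?_eq_none.1 e ⟨0, cfg.numClasses_pos⟩ (List.mem_finRange _)
  have hn : 0 < n := by
    rcases Nat.eq_zero_or_pos n with rfl | h
    · simp at this
    · exact h
  have := sbWords_pos
  exact Nat.div_pos (by omega) (by omega)

section
variable {t : T} {live : Set ℕ} {h : Heap cfg} {γ : Ghost cfg T} {q : Caches cfg}

/-- The label of a cached block names its class, so the block removed occurs in no other cache of
the thread. -/
lemma CacheInv.remove (ci : CacheInv γ t q) {c : cfg.Cls} {b : ℕ} {L : List ℕ}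
    (e : q c = b :: L) (x : Place cfg T) :
    CacheInv { γ with place := Function.update γ.place b x } t (Function.update q c L) := by
  intro c'
  have hb := (ci c).2 b (by simp [e])
  by_cases hc : c' = c
  · subst hc
    have h1 := ci c'
    rw [e, List.nodup_cons] at h1
    simp only [Function.update_self]
    refine ⟨h1.1.2, fun a ha => ?_⟩
    have : a ≠ b := by rintro rfl; exact h1.1.1 ha
    have h2 := h1.2 a (by simp [ha])
    exact ⟨(Function.update_of_ne this _ _).trans h2.1, h2.2⟩
  · rw [Function.update_of_ne hc]
    refine ⟨(ci c').1, fun a ha => ?_⟩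
    have h2 := (ci c').2 a ha
    have : a ≠ b := by rintro rfl; rw [h2.1] at hb; simp [hc] at hb
    exact ⟨(Function.update_of_ne this _ _).trans h2.1, h2.2⟩

lemma CacheInv.add (ci : CacheInv γ t q) {c : cfg.Cls} {b : ℕ}
    (hb : ∀ c', γ.place b ≠ .cached t c') (hs : SBlock γ c b) :
    CacheInv { γ with place := Function.update γ.place b (.cached t c) } t
      (Function.update q c (b :: q c)) := by
  have hn : ∀ c', ∀ a ∈ q c', a ≠ b := by
    rintro c' a ha rfl
    exact hb c' ((ci c').2 a ha).1
  have hold : ∀ c', ∀ a ∈ q c', Function.update γ.place b (.cached t c) a = .cached t c' ∧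
      SBlock γ c' a := fun c' a ha =>
    have h2 := (ci c').2 a ha
    ⟨(Function.update_of_ne (hn c' a ha) _ _).trans h2.1, h2.2⟩
  intro c'
  by_cases hc : c' = c
  · subst hc
    simp only [Function.update_self, List.nodup_cons, List.mem_cons]
    refine ⟨⟨fun hm => hn c' b hm rfl, (ci c').1⟩, ?_⟩
    rintro a (rfl | ha)
    · exact ⟨Function.update_self .., hs⟩
    · exact hold c' a ha
  · rw [Function.update_of_ne hc]
    exact ⟨(ci c').1, hold c'⟩

/-- Every step of a thread inside the allocator preserves the invariant. -/
theorem exec_invariant (G : GInv h live γ) (ci : CacheInv γ t q) {pc : PC cfg}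
    (i : PCInv h γ t pc) : ∃ γ', Trans t live h γ (exec h q pc).2.1 γ' ∧
      CacheInv γ' t (exec h q pc).2.2 ∧ PCInv (exec h q pc).2.1 γ' t (exec h q pc).1 ∧
      γ'.partLen + pops h pc = γ.partLen + pushes h pc := by
  cases pc with
  | idle => exact ⟨γ, .refl G, ci, i, rfl⟩
  | ret v => exact ⟨γ, .refl G, ci, i, rfl⟩
  | mallocStart n =>
    cases e : cfg.classFor n with
    | some c => simp only [exec, e]; exact ⟨γ, .refl G, ci, trivial, rfl⟩
    | none => simp only [exec, e]; exact ⟨γ, .refl G, ci, largeCount_pos e, rfl⟩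
  | take c =>
    cases e : q c with
    | cons b L =>
      simp only [exec, e]
      have hb := (ci c).2 b (by simp [e])
      exact ⟨_, G.updatePlace (a := b) (x := .param t) (by rw [hb.1]; rfl), ci.remove e _,
        .inl ⟨c, Function.update_self .., hb.2⟩, rfl⟩
    | nil => simp only [exec, e]; exact ⟨γ, .refl G, ci, trivial, rfl⟩
  | ppLoad c =>
    cases e : (h.partialHead c).ptr with
    | some d => simp only [exec, e]; exact ⟨γ, .refl G, ci, ⟨e, le_rfl⟩, rfl⟩
    | none => simp only [exec, e]; exact ⟨γ, .refl G, ci, trivial, rfl⟩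
  | ppNext c old d => exact ⟨γ, .refl G, ci, ⟨i, fun _ => rfl⟩, rfl⟩
  | ppCas c old d next =>
    by_cases e : h.partialHead c = old
    · simp only [exec, if_pos e, pops, pushes]
      obtain ⟨⟨i1, -⟩, i3⟩ := i
      subst e
      have hd := G.own_part_ptr i1
      obtain ⟨h1, h2⟩ := G.popPartial (t := t) i1 (i3 rfl)
      have hk : Keep t γ { γ.setStatus d c (.held t) with
          partL := Function.update γ.partL c (γ.partL c).tail } := keep_setStatus hd
      refine ⟨_, h1, hk.cacheInv ci, if_pos rfl, ?_⟩
      have := sum_length_update γ.partL c (γ.partL c).tail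
      simp only [Ghost.partLen]
      omega
    · simp only [exec, if_neg e, pops]; exact ⟨γ, .refl G, ci, trivial, rfl⟩
  | rsLoad c d =>
    by_cases e : (h.anchor d).state = .EMPTY
    · simp only [exec, if_pos e]
      obtain ⟨h1, h2⟩ := G.retire i e
      exact ⟨_, h1, h2.cacheInv ci, ⟨⟨le_rfl, le_rfl, fun x => own_setOwn_of_mem, by omega⟩,
        trivial⟩, rfl⟩
    · simp only [exec, if_neg e]; exact ⟨γ, .refl G, ci, i, rfl⟩
  | rsCas c d old =>
    by_cases e : h.anchor d = old
    · simp only [exec, if_pos e]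
      subst e
      obtain ⟨γ', L, h1, h2, h3, h4, h5⟩ := G.reserve i
      exact ⟨γ', h1, h2.cacheInv ci, ⟨L, h3, h4⟩, by rw [Ghost.partLen, h5]; rfl⟩
    · simp only [exec, if_neg e]; exact ⟨γ, .refl G, ci, i, rfl⟩
  | walk c a n =>
    cases n with
    | zero => exact ⟨γ, .refl G, ci, trivial, rfl⟩
    | succ n =>
      obtain ⟨L, ⟨l1, l2, l3⟩, l4⟩ := i
      cases L with
      | nil => simp at l4
      | cons b L =>
        obtain ⟨rfl, l2⟩ := l2
        have ha := l3 a (by simp)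
        refine ⟨_, G.updatePlace (a := a) (x := .cached t c) (by rw [ha.1]; rfl),
          ci.add (by simp [ha.1]) ha.2, ⟨L, ⟨l1.tail, l2, fun x hx => ?_⟩, by simpa using l4⟩, rfl⟩
        have : x ≠ a := by rintro rfl; exact (List.nodup_cons.1 l1).1 hx
        have h2 := l3 x (by simp [hx])
        exact ⟨(Function.update_of_ne this _ _).trans h2.1, h2.2⟩
  | pfLoad c =>
    cases e : h.freeHead.ptr with
    | some d => simp only [exec, e]; exact ⟨γ, .refl G, ci, ⟨e, le_rfl⟩, rfl⟩
    | none => simp only [exec, e]; exact ⟨γ, .refl G, ci, trivial, rfl⟩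
  | pfNext c old d => exact ⟨γ, .refl G, ci, ⟨i, fun _ => rfl⟩, rfl⟩
  | pfCas c old d next =>
    by_cases e : h.freeHead = old
    · simp only [exec, if_pos e]
      obtain ⟨⟨i1, -⟩, i3⟩ := i
      subst e
      obtain ⟨h1, h2⟩ := G.popFree t i1 (i3 rfl)
      exact ⟨_, h1, h2.cacheInv ci, own_setOwn_of_mem le_rfl (by omega), rfl⟩
    · simp only [exec, if_neg e]; exact ⟨γ, .refl G, ci, trivial, rfl⟩
  | nsClass c d =>
    exact ⟨γ, G.writeSizeClass i _, ci, ⟨i, Function.update_self ..⟩, rfl⟩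
  | nsSize c d =>
    exact ⟨γ, G.writeBlockSize i.1 _, ci, ⟨i.1, i.2, Function.update_self ..⟩, rfl⟩
  | nsPersist c d => exact ⟨γ, .refl G, ci, i, rfl⟩
  | nsLoad c d => exact ⟨γ, .refl G, ci, i, rfl⟩
  | nsCas c d old =>
    by_cases e : h.anchor d = old
    · simp only [exec, if_pos e]
      obtain ⟨γ', h1, h2, h3⟩ := G.makeSmall i.1 i.2.1 i.2.2
      exact ⟨γ', h1, h2 q ci, trivial, by rw [Ghost.partLen, h3]; rfl⟩
    · simp only [exec, if_neg e]; exact ⟨γ, .refl G, ci, i, rfl⟩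
  | exLoad c =>
    by_cases e : h.used < cfg.capacity
    · simp only [exec, if_pos e]
      have := cfg.increment_pos
      exact ⟨γ, .refl G, ci, ⟨by omega, by omega⟩, rfl⟩
    · simp only [exec, if_neg e]; exact ⟨γ, .refl G, ci, trivial, rfl⟩
  | exCas c u v =>
    by_cases e : h.used = u
    · simp only [exec, if_pos e]
      subst e
      obtain ⟨h1, h2⟩ := G.extend t i.1.le
      exact ⟨_, h1, h2.cacheInv ci, ⟨i.1, fun x => own_setOwn_of_mem⟩, rfl⟩
    · simp only [exec, if_neg e]; exact ⟨γ, .refl G, ci, trivial, rfl⟩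
  | exPersist c u v =>
    obtain ⟨i1, i2⟩ := i
    exact ⟨γ, .refl G, ci, ⟨⟨le_rfl, by omega, fun x h1 h2 => i2 x h1 (by omega), by omega⟩,
      trivial⟩, rfl⟩
  | link first last j k =>
    obtain ⟨⟨i1, i2, i3, i4⟩, i5⟩ := i
    by_cases e : j < last
    · simp only [exec, if_pos e]
      refine ⟨γ, G.writeNextFree (i3 j i1 (by omega)) _, ci, ⟨⟨by omega, e, i3, fun x h1 h2 => ?_⟩,
        i5⟩, rfl⟩
      by_cases hx : x = j
      · subst hx; simp
      · simpa [hx] using i4 x h1 (by omega)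
    · simp only [exec, if_neg e]
      obtain rfl : j = last := by omega
      exact ⟨γ, .refl G, ci, ⟨⟨i1, i2, i3, i4⟩, i5⟩, rfl⟩
  | pushLoad first last k => exact ⟨γ, .refl G, ci, i, rfl⟩
  | pushNext first last old k =>
    obtain ⟨⟨i1, i2, i3, i4⟩, i5⟩ := i
    refine ⟨γ, G.writeNextFree (i3 last i1 (by omega)) _, ci, ⟨⟨⟨i1, i2, i3, fun x h1 h2 => ?_⟩,
      Function.update_self ..⟩, i5⟩, rfl⟩
    exact (Function.update_of_ne (by omega) _ _).trans (i4 x h1 h2)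
  | pushCas first last old k =>
    by_cases e : h.freeHead = old
    · simp only [exec, if_pos e]
      subst e
      obtain ⟨⟨i1, i2⟩, i3⟩ := i
      obtain ⟨γ', h1, h2, h3⟩ := G.pushFree i1 i2
      refine ⟨γ', h1, h2.cacheInv ci, ?_, by rw [Ghost.partLen, h3]; rfl⟩
      cases k with
      | flush c p => exact h2.smallParam i3
      | _ => trivial
    · simp only [exec, if_neg e]; exact ⟨γ, .refl G, ci, ⟨i.1.1, i.2⟩, rfl⟩
  | lgLoad m =>
    by_cases e : h.used + m ≤ cfg.capacity
    · simp only [exec, if_pos e]; exact ⟨γ, .refl G, ci, ⟨i, e⟩, rfl⟩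
    · simp only [exec, if_neg e]; exact ⟨γ, .refl G, ci, trivial, rfl⟩
  | lgCas m u =>
    by_cases e : h.used = u
    · simp only [exec, if_pos e]
      subst e
      obtain ⟨h1, h2⟩ := G.extend t (Nat.le_add_right h.used m)
      exact ⟨_, h1, h2.cacheInv ci, ⟨i.1, fun x => own_setOwn_of_mem⟩, rfl⟩
    · simp only [exec, if_neg e]; exact ⟨γ, .refl G, ci, i.1, rfl⟩
  | lgPersistUsed m u => exact ⟨γ, .refl G, ci, i, rfl⟩
  | lgClass m u =>
    exact ⟨γ, G.writeSizeClass (i.2 u le_rfl (by have := i.1; omega)) _, ci,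
      ⟨i.1, i.2, Function.update_self ..⟩, rfl⟩
  -- At this write the superblocks turn into a large block, since class and size are now both
  -- recorded.
  | lgSize m u =>
    obtain ⟨i1, i2, i3⟩ := i
    have h0 := G.writeBlockSize (i2 u le_rfl (by omega)) (m * sbWords)
    obtain ⟨γ', h1, h2, h3, h4⟩ := h0.ginv.makeLarge i2 i1 i3 (Function.update_self ..)
    exact ⟨γ', h0.trans h1, h3 q ci, h2, by rw [Ghost.partLen, h4]; rfl⟩
  | lgAnchor u =>
    have h1 := i.2.1
    rw [sbOf_mul] at h1
    exact ⟨γ, G.writeAnchor (by simp [h1]) _, ci, i, rfl⟩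
  | lgPersist u => exact ⟨γ, .refl G, ci, .inr i, rfl⟩
  | freeStart p =>
    rcases i with ⟨c, hp, hs⟩ | ⟨hp, hl⟩
    · have e : h.sizeClass (sbOf p) = some c := by
        obtain ⟨st, hs⟩ := hs.1
        exact (G.small _ _ _ hs).sizeClass_eq
      by_cases e' : (q c).length < cfg.cacheCap c
      · simp only [exec, e, if_pos e']
        exact ⟨_, G.updatePlace (a := p) (x := .cached t c) (by rw [hp]; rfl),
          ci.add (by simp [hp]) hs, trivial, rfl⟩
      · simp only [exec, e, if_neg e']; exact ⟨γ, .refl G, ci, ⟨hp, hs⟩, rfl⟩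
    · have e := (G.large _ _ hl.1).1
      simp only [exec, e]
      refine ⟨γ, .refl G, ci, ?_, rfl⟩
      show LargeParam γ t _
      rw [← hl.2]
      exact ⟨hp, hl⟩
  | frSize d =>
    have h1 := i.2.1
    rw [sbOf_mul] at h1
    obtain ⟨-, m, -, h2, -⟩ := G.large _ _ h1
    have h3 : h.blockSize d = h.blockSize d / sbWords * sbWords := by
      rw [h2, Nat.mul_div_cancel _ sbWords_pos]
    exact ⟨γ, .refl G, ci, ⟨i, h3⟩, rfl⟩
  | frAnchor d m =>
    obtain ⟨h1, h2⟩ := G.freeLarge i.1 i.2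
    have hd : (γ.setOwn d (d + m) (.excl t)).own d = .excl t :=
      own_setOwn_of_mem le_rfl (by omega)
    have h3 := h1.ginv.writeAnchor (t := t) (d := d) (by simp [hd]) ⟨0, 0, .EMPTY⟩
    refine ⟨_, h1.trans h3, fun c => ⟨(ci c).1, fun a ha => ?_⟩,
      ⟨⟨le_rfl, by omega, fun x h4 h5 => own_setOwn_of_mem h4 (by omega), by omega⟩, trivial⟩, rfl⟩
    obtain ⟨c1, ⟨st, c2⟩, c3⟩ := (ci c).2 a ha
    have hl := i.1.2.1
    rw [sbOf_mul] at hl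
    obtain ⟨-, m', -, h6, h7⟩ := G.large d d hl
    obtain rfl : m = m' := Nat.eq_of_mul_eq_mul_right sbWords_pos (i.2.symm.trans h6)
    refine ⟨c1, ⟨st, (own_setOwn_of_not_mem fun hm => ?_).trans c2⟩, c3⟩
    rw [(h7 _).2 hm] at c2
    cases c2
  | flush c p =>
    cases e : q c with
    | nil =>
      simp only [exec, e]
      refine ⟨_, G.updatePlace (a := p) (x := .cached t c) (by rw [i.1]; rfl), ?_, trivial, rfl⟩
      have := ci.add (by simp [i.1]) i.2
      rwa [e] at this
    | cons b L =>
      simp only [exec, e]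
      have hb := (ci c).2 b (by simp [e])
      have hne : p ≠ b := by rintro rfl; have := i.1; rw [hb.1] at this; cases this
      refine ⟨_, G.updatePlace (a := b) (x := .seg t) (by rw [hb.1]; rfl), ci.remove e _,
        ⟨⟨(Function.update_of_ne hne _ _).trans i.1, i.2⟩, [],
          ⟨by simp, ⟨rfl, trivial⟩, fun x hx => ?_⟩, rfl, by simp⟩, rfl⟩
      obtain rfl : x = b := by simpa using hx
      exact ⟨Function.update_self .., hb.2⟩
  | gather c p d head tail n =>
    cases e : q c with
    | nil => simp only [exec, e]; exact ⟨γ, .refl G, ci, i, rfl⟩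
    | cons b L =>
      by_cases e' : sbOf b = d
      · simp only [exec, e, if_pos e']
        have hb := (ci c).2 b (by simp [e])
        obtain ⟨ip, M, ⟨m1, m2, m3⟩, m4, m5⟩ := i
        have hne : p ≠ b := by rintro rfl; have := ip.1; rw [hb.1] at this; cases this
        have hbM : ∀ x ∈ M ++ [tail], x ≠ b := by
          rintro x hx rfl
          have := (m3 x hx).1
          rw [hb.1] at this
          cases this
        have h1 := G.updatePlace (a := b) (x := .seg t) (by rw [hb.1]; rfl)
        -- The first word of `b` may be overwritten because `b` has just been labelled as part of
        -- the chain of `t`.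
        have h2 := h1.ginv.writeMem (t := t) (b := b) (w := head) (Function.update_self ..)
        refine ⟨_, h1.trans h2, ci.remove e _, ⟨⟨(Function.update_of_ne hne _ _).trans ip.1, ip.2⟩,
          b :: M, ⟨?_, ⟨rfl, ?_⟩, fun x hx => ?_⟩, by simp [m4], fun x hx => ?_⟩, rfl⟩
        · exact List.nodup_cons.2 ⟨fun hm => hbM b hm rfl, m1⟩
        · simp only [Function.update_self]
          exact m2.congr fun x hx => Function.update_of_ne (hbM x hx) _ _
        · rcases List.mem_cons.1 hx with rfl | hx
          · exact ⟨Function.update_self .., hb.2⟩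
          · exact ⟨(Function.update_of_ne (hbM x hx) _ _).trans (m3 x hx).1, (m3 x hx).2⟩
        · rcases List.mem_cons.1 hx with rfl | hx
          · exact e'
          · exact m5 x hx
      · simp only [exec, e, if_neg e']; exact ⟨γ, .refl G, ci, i, rfl⟩
  | flLoad c p d head tail n => exact ⟨γ, .refl G, ci, i, rfl⟩
  | flNext c p d head tail n old =>
    obtain ⟨ip, M, ⟨m1, m2, m3⟩, m4, m5⟩ := i
    exact ⟨γ, G.writeMem (t := t) (m3 tail (by simp)).1, ci,
      ⟨⟨ip, M, ⟨m1, m2.update_last m1, m3⟩, m4, m5⟩, Function.update_self ..⟩, rfl⟩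
  | flCas c p d head tail n old =>
    by_cases e : h.anchor d = old
    · subst e
      obtain ⟨γ', h1, h2, h3, h4⟩ := G.returnBlocks i.1 i.2
      have hp := h2.smallParam i.1.1
      simp only [exec, if_true]
      by_cases e1 : (h.anchor d).state = .FULL
      · by_cases e2 : (pushAnchor cfg c (h.anchor d) head n).state = .EMPTY
        · simp only [if_pos e1, if_pos e2]
          -- Two ghost transitions in one step: the CAS returns the last missing blocks, and the
          -- superblock, now held and EMPTY, is retired at once.
          obtain ⟨h5, h6⟩ := h1.ginv.retire (h3 e1) (by simpa using e2)
          exact ⟨_, h1.trans h5, (h2.trans h6).cacheInv ci,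
            ⟨⟨le_rfl, le_rfl, fun x => own_setOwn_of_mem, by omega⟩, h6.smallParam hp⟩,
            by rw [Ghost.partLen, Ghost.setOwn, h4]; rfl⟩
        · simp only [if_pos e1, if_neg e2]
          exact ⟨γ', h1, h2.cacheInv ci, ⟨hp, h3 e1⟩, by rw [Ghost.partLen, h4]; rfl⟩
      · simp only [if_neg e1]
        exact ⟨γ', h1, h2.cacheInv ci, hp, by rw [Ghost.partLen, h4]; rfl⟩
    · simp only [exec, if_neg e]; exact ⟨γ, .refl G, ci, i.1, rfl⟩
  | qpLoad c p d => exact ⟨γ, .refl G, ci, i, rfl⟩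
  | qpNext c p d old =>
    exact ⟨γ, G.writeNextPartial i.2 _, ci, ⟨i, Function.update_self ..⟩, rfl⟩
  | qpCas c p d old =>
    by_cases e : h.partialHead c = old
    · simp only [exec, if_pos e, pops, pushes]
      subst e
      have h1 := G.pushPartial i.1.2 i.2
      have hk : Keep t γ { γ.setStatus d c .listed with
          partL := Function.update γ.partL c (d :: γ.partL c) } := keep_setStatus i.1.2
      refine ⟨_, h1, hk.cacheInv ci, hk.smallParam i.1.1, ?_⟩
      have := sum_length_update γ.partL c (d :: γ.partL c)
      simp only [Ghost.partLen, List.length_cons] at this ⊢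
      omega
    · simp only [exec, if_neg e, pushes]; exact ⟨γ, .refl G, ci, i.1, rfl⟩

end

/-! ### Initial states, calls and returns -/

/-- The invariant of the whole system. -/
def Inv (s : Sys cfg T) (γ : Ghost cfg T) : Prop :=
  GInv s.heap s.live γ ∧ ∀ t, CacheInv γ t (s.cache t) ∧ PCInv s.heap γ t (s.pc t)

open Classical in
/-- The invariant holds initially. -/
lemma Sys.IsInitial.exists_inv {s : Sys cfg T} (hs : s.IsInitial) : ∃ γ, Inv s γ := by
  obtain ⟨hpc, hq, kind, freeL, partL, W⟩ := hs
  -- In a quiescent heap no thread holds a superblock, so those that are not FULL are all listed,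
  -- the EMPTY ones included.
  let st : ℕ → Status T := fun d => if (s.heap.anchor d).state = .FULL then .full else .listed
  let own : ℕ → Own cfg T := fun d => if d < s.heap.used then
    match kind d with
    | .free => .free
    | .small c => .small c (st d)
    | .large e => .large e
    else .unused
  have hsmall : ∀ d c x, own d = .small c x →
      d < s.heap.used ∧ kind d = .small c ∧ x = st d := by
    intro d c x h
    by_cases hd : d < s.heap.used
    · simp only [own, if_pos hd] at h
      cases hk : kind d <;> simp_all
    · simp [own, hd] at h
  have hlarge : ∀ d e, own d = .large e ↔ d < s.heap.used ∧ kind d = .large e := by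
    intro d e
    by_cases hd : d < s.heap.used
    · simp only [own, if_pos hd]
      cases hk : kind d <;> simp_all
    · simp [own, hd]
  -- As all caches are empty, every address that is not a block in use may be labelled `.chain`.
  refine ⟨⟨own, fun a => if a ∈ s.live then .live else .chain, freeL, partL⟩,
    ⟨fun d hd => if_neg (by omega), W.free_linked, W.free_nodup, fun d hd => ?_, W.part_linked,
      W.part_nodup, fun c d hd => ?_, fun d c x h => ?_, fun d e h => ?_, fun a ha => ?_⟩,
    fun t => ⟨fun c => by simp [hq], by rw [hpc]; trivial⟩⟩
  · obtain ⟨h1, h2⟩ := (W.mem_free d).1 hd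
    simp [own, h1, h2]
  · obtain ⟨h1, h2, h3⟩ := (W.mem_part c d).1 hd
    simp [own, h1, h2, st, h3]
  · obtain ⟨h1, h2, rfl⟩ := hsmall d c x h
    obtain ⟨o1, o2, ⟨L, l1, l2, l3, l4⟩, o4, o5⟩ := W.small_ok d h1 c h2
    refine ⟨o1, o2, ⟨L, l1, l2, l3, fun a ha => ?_⟩, ?_, o5.1⟩
    · obtain ⟨⟨i, hi, rfl⟩, h4⟩ := (l4 a).1 ha
      exact ⟨if_neg h4, sbOf_blockAddr hi, isAddr_blockAddr hi⟩
    · by_cases hF : (s.heap.anchor d).state = .FULL <;> simp [st, hF]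
  · obtain ⟨h1, h2⟩ := (hlarge d e).1 h
    obtain ⟨o1, -, m, o3, o4, o5, o6⟩ := W.large_ok d h1 e h2
    refine ⟨o1, m, o3, o4, fun x => (hlarge x e).trans ⟨fun hx => (o6 x hx.1).1 hx.2, fun hx => ?_⟩⟩
    have : x < s.heap.used := by omega
    exact ⟨this, (o6 x this).2 hx⟩
  · refine ⟨if_pos ha, ?_⟩
    rcases W.live_block a ha with ⟨d, h1, c, h2, i, hi, rfl⟩ | ⟨e, h1, h2, rfl⟩
    · refine .inl ⟨c, ⟨st d, ?_⟩, isAddr_blockAddr hi⟩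
      rw [sbOf_blockAddr hi]
      simp [own, h1, h2]
    · refine .inr ⟨?_, by rw [sbOf_mul]⟩
      rw [sbOf_mul]
      exact (hlarge e e).2 ⟨h1, h2⟩

section
variable {t : T} {live : Set ℕ} {h : Heap cfg} {γ : Ghost cfg T}

/-- The application passes a block to `free`. -/
lemma GInv.callFree (G : GInv h live γ) (t : T) {p : ℕ} (hp : p ∈ live) :
    GInv h (live \ {p}) { γ with place := Function.update γ.place p (.param t) } ∧
      (∀ t', Stable t' h γ h { γ with place := Function.update γ.place p (.param t) }) ∧
      PCInv h { γ with place := Function.update γ.place p (.param t) } t (.freeStart p) := by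
  obtain ⟨hp1, hp2⟩ := G.live_block p hp
  refine ⟨⟨G.unused, G.free_linked, G.free_nodup, G.mem_free, G.part_linked, G.part_nodup,
    G.mem_part, fun d c st e => (G.small d c st e).frame rfl rfl rfl fun b hb _ _ => ?_,
    G.large, fun b hb => ?_⟩, fun t' => ⟨by simp, by simp, fun b c hb hs => ?_,
      fun b hb hs => ?_, by simp, by simp⟩, ?_⟩
  · have : b ≠ p := by rintro rfl; simp_all
    simp [this, hb]
  · have h1 := G.live_block b hb.1
    exact ⟨(Function.update_of_ne hb.2 _ _).trans h1.1, h1.2⟩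
  · have : b ≠ p := by rintro rfl; simp_all [Place.thread?]
    exact ⟨Function.update_of_ne this _ _, hs, rfl⟩
  · have : b ≠ p := by rintro rfl; simp_all
    exact ⟨(Function.update_of_ne this _ _).trans hb, hs, rfl⟩
  · exact hp2.imp (fun ⟨c, hc⟩ => ⟨c, Function.update_self .., hc⟩)
      fun hl => ⟨Function.update_self .., hl⟩

/-- `malloc` returns a block. -/
lemma GInv.response (G : GInv h live γ) {p : ℕ} (hp : PCInv h γ t (.ret (some p))) :
    Trans t (live ∪ {p}) h γ h { γ with place := Function.update γ.place p .live } := by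
  have hp1 : γ.place p = .param t ∧ ((∃ c, SBlock γ c p) ∨ LBlock γ p) := by
    rcases hp with ⟨c, h1, h2⟩ | ⟨h1, h2⟩
    · exact ⟨h1, .inl ⟨c, h2⟩⟩
    · exact ⟨h1, .inr h2⟩
  have h1 := G.updatePlace (t := t) (a := p) (x := .live) (by rw [hp1.1]; rfl)
  refine ⟨⟨G.unused, G.free_linked, G.free_nodup, G.mem_free, G.part_linked, G.part_nodup,
    G.mem_part, h1.ginv.small, h1.ginv.large, fun a ha => ?_⟩, h1.stable⟩
  rcases ha with ha | rfl
  · exact h1.ginv.live_block a ha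
  · exact ⟨Function.update_self .., hp1.2⟩

end

/-! ### The termination measure -/

/-- Bound, for each continuation, on the number of successful CAS operations to come. -/
def Cont.weight (q : Caches cfg) : Cont cfg → ℕ
  | .popFree _ => 2
  | .popPartial _ => 2
  | .flush c _ => 4 * (q c).length
  | .done => 0

/-- Bound on the number of successful CAS operations to come before the thread returns, as long
as it pops no superblock from a partial list and extends no prefix. -/
def weight (q : Caches cfg) : PC cfg → ℕ
  -- One more than `.freeStart`, and more than `.mallocStart`, so that each call lowers the
  -- potential.
  | .idle => 3 + 4 * ∑ c, (q c).length
  | .ret _ => 0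
  | .mallocStart _ => 2
  | .take c => if q c = [] then 2 else 0
  | .ppLoad _ => 2
  | .ppNext _ _ _ => 2
  | .ppCas _ _ _ _ => 2
  -- The rise from 2 to 3 after a pop is paid for by the two units of the superblock that left the
  -- partial list. The rise at `.exPersist` is paid for likewise by the growth of the used prefix.
  | .rsLoad _ _ => 3
  | .rsCas _ _ _ => 3
  | .walk _ _ _ => 2
  | .pfLoad _ => 2
  | .pfNext _ _ _ => 2
  | .pfCas _ _ _ _ => 2
  | .nsClass _ _ => 1
  | .nsSize _ _ => 1
  | .nsPersist _ _ => 1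
  | .nsLoad _ _ => 1
  | .nsCas _ _ _ => 1
  | .exLoad _ => 2
  | .exCas _ _ _ => 2
  | .exPersist _ _ _ => 3
  | .link _ _ _ k => 1 + k.weight q
  | .pushLoad _ _ k => 1 + k.weight q
  | .pushNext _ _ _ k => 1 + k.weight q
  | .pushCas _ _ _ k => 1 + k.weight q
  | .lgLoad _ => 0
  | .lgCas _ _ => 0
  | .lgPersistUsed _ _ => 1
  | .lgClass _ _ => 1
  | .lgSize _ _ => 1
  -- The plain writes to an anchor, here and at `.frAnchor`, change a word on which CAS operations
  -- are performed, so they cost a unit as well.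
  | .lgAnchor _ => 1
  | .lgPersist _ => 0
  | .freeStart _ => 2 + 4 * ∑ c, (q c).length
  | .frSize _ => 2
  | .frAnchor _ _ => 2
  -- Each run contains at least one cached block. It costs at most 4: one for the CAS on the anchor
  -- and three for a push to a partial list, two of which go to the superblock added there.
  | .flush c _ => 4 * (q c).length
  | .gather c _ _ _ _ _ => 4 * (q c).length + 4
  | .flLoad c _ _ _ _ _ => 4 * (q c).length + 4
  | .flNext c _ _ _ _ _ _ => 4 * (q c).length + 4
  | .flCas c _ _ _ _ _ _ => 4 * (q c).length + 4
  | .qpLoad c _ _ => 4 * (q c).length + 3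
  | .qpNext c _ _ _ => 4 * (q c).length + 3
  | .qpCas c _ _ _ => 4 * (q c).length + 3

/-- Bound on the number of steps until the thread succeeds with a CAS, or returns, provided that
no other thread changes a word on which a CAS is performed. -/
def steps (h : Heap cfg) (q : Caches cfg) : PC cfg → ℕ
  | .idle => 0
  | .ret _ => 0
  | .mallocStart _ => 6
  | .take _ => 5
  | .ppLoad _ => 4
  -- With an outdated head, 6 counts this read, the failing CAS and the 4 steps from `.ppLoad`. The
  -- other retry loops are counted in the same way.
  | .ppNext c old _ => if h.partialHead c = old then 2 else 6
  | .ppCas c old _ _ => if h.partialHead c = old then 1 else 5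
  -- Must exceed the value 4 of `.link` for a single descriptor.
  | .rsLoad _ _ => 5
  | .rsCas _ d old => if h.anchor d = old then 1 else 6
  -- After `n` moves and the final test, the value 5 of `.take` has to remain.
  | .walk _ _ n => 6 + n
  | .pfLoad _ => 3
  | .pfNext _ old _ => if h.freeHead = old then 2 else 5
  | .pfCas _ old _ _ => if h.freeHead = old then 1 else 4
  | .nsClass _ _ => 5
  | .nsSize _ _ => 4
  | .nsPersist _ _ => 3
  | .nsLoad _ _ => 2
  | .nsCas _ d old => if h.anchor d = old then 1 else 3
  | .exLoad _ => 2
  | .exCas _ u _ => if h.used = u then 1 else 3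
  | .exPersist _ u v => 5 + (v - 1 - u)
  | .link _ last i _ => 4 + (last - i)
  | .pushLoad _ _ _ => 3
  | .pushNext _ _ old _ => if h.freeHead = old then 2 else 5
  | .pushCas _ _ old _ => if h.freeHead = old then 1 else 4
  | .lgLoad _ => 2
  | .lgCas _ u => if h.used = u then 1 else 3
  | .lgPersistUsed _ _ => 4
  | .lgClass _ _ => 3
  | .lgSize _ _ => 2
  | .lgAnchor _ => 1
  | .lgPersist _ => 1
  | .freeStart _ => 6 + ∑ c, (q c).length
  | .frSize _ => 2
  | .frAnchor _ _ => 1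
  | .flush c _ => 5 + (q c).length
  | .gather c _ _ _ _ _ => 4 + (q c).length
  | .flLoad _ _ _ _ _ _ => 3
  | .flNext _ _ d _ _ _ old => if h.anchor d = old then 2 else 5
  | .flCas _ _ d _ _ _ old => if h.anchor d = old then 1 else 4
  | .qpLoad _ _ _ => 3
  | .qpNext c _ _ old => if h.partialHead c = old then 2 else 5
  | .qpCas c _ _ old => if h.partialHead c = old then 1 else 4

/-- The words on which CAS operations are performed are the same. -/
def SameWords (h h' : Heap cfg) : Prop :=
  h'.used = h.used ∧ h'.freeHead = h.freeHead ∧ h'.partialHead = h.partialHead ∧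
    h'.anchor = h.anchor

/-- `steps` reads the heap only to compare such a word with a value loaded earlier. Hence a step
that changes none of them leaves the terms of all other threads alone. -/
lemma SameWords.steps_eq {h h' : Heap cfg} (e : SameWords h h') (q : Caches cfg) (pc : PC cfg) :
    steps h' q pc = steps h q pc := by
  obtain ⟨e1, e2, e3, e4⟩ := e
  cases pc <;> simp only [steps, e1, e2, e3, e4]

lemma length_le_sum (q : Caches cfg) (c : cfg.Cls) : (q c).length ≤ ∑ c, (q c).length :=
  Finset.single_le_sum (f := fun c => (q c).length) (fun _ _ => Nat.zero_le _) (Finset.mem_univ c)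

/-- Every step of a thread either makes progress in terms of successful CAS operations, or comes
closer to such an operation. -/
theorem exec_measure {h : Heap cfg} {q : Caches cfg} {γ : Ghost cfg T} {t : T} {pc : PC cfg}
    (i : PCInv h γ t pc) (not_idle : pc ≠ .idle) (not_ret : ∀ v, pc ≠ .ret v) :
    2 * (cfg.capacity - (exec h q pc).2.1.used) + 2 * pushes h pc +
        weight (exec h q pc).2.2 (exec h q pc).1 <
      2 * (cfg.capacity - h.used) + 2 * pops h pc + weight q pc ∨
    SameWords h (exec h q pc).2.1 ∧ pushes h pc = 0 ∧ pops h pc = 0 ∧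
      weight (exec h q pc).2.2 (exec h q pc).1 ≤ weight q pc ∧
      steps (exec h q pc).2.1 (exec h q pc).2.2 (exec h q pc).1 < steps h q pc := by
  cases pc with
  | idle => exact absurd rfl not_idle
  | ret v => exact absurd rfl (not_ret v)
  | mallocStart n =>
    cases e : cfg.classFor n with
    | some c =>
      simp only [exec, e, pops, pushes, weight, steps, SameWords]
      split_ifs <;> simp
    | none => simp [exec, e, pops, pushes, weight, steps, SameWords]
  | take c =>
    cases e : q c <;> simp [exec, e, pops, pushes, weight, steps, SameWords]
  | ppLoad c =>
    cases e : (h.partialHead c).ptr <;> simp [exec, e, pops, pushes, weight, steps, SameWords]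
  | pfLoad c =>
    cases e : h.freeHead.ptr <;> simp [exec, e, pops, pushes, weight, steps, SameWords]
  | walk c a n =>
    cases n with
    | zero => by_cases e : q c = [] <;> simp [exec, e, pops, pushes, weight, steps, SameWords]
    | succ n => simp [exec, pops, pushes, weight, steps, SameWords]
  | nsCas c d old =>
    by_cases e : h.anchor d = old
    -- A superblock has at least one block, so the cache is nonempty afterwards and `.take` has
    -- weight 0.
    · have := (numBlocks_pos c).ne'
      simp [exec, e, pops, pushes, weight, this]
    · simp [exec, e, pops, pushes, weight, steps, SameWords]
  | exCas c u v =>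
    by_cases e : h.used = u
    -- The invariant gives `u < v ≤ cfg.capacity`; the upper bound makes the truncated subtraction
    -- decrease strictly.
    · simp only [PCInv] at i
      simp only [exec, e, pops, pushes, weight, if_true]
      omega
    · simp [exec, e, pops, pushes, weight, steps, SameWords]
  | lgCas m u =>
    by_cases e : h.used = u
    · simp only [PCInv] at i
      simp only [exec, e, pops, pushes, weight, if_true]
      omega
    · simp [exec, e, pops, pushes, weight, steps, SameWords]
  | link first last j k =>
    by_cases e : j < last
    · simp [exec, e, pops, pushes, weight, steps, SameWords]
      omega
    · simp [exec, e, pops, pushes, weight, steps, SameWords]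
      omega
  | pushCas first last old k =>
    by_cases e : h.freeHead = old
    · cases k <;> simp [exec, e, pops, pushes, weight, Cont.pc, Cont.weight]
    · simp [exec, e, pops, pushes, weight, steps, SameWords]
  | freeStart p =>
    cases e : h.sizeClass (sbOf p) with
    | none => simp [exec, e, pops, pushes, weight, steps, SameWords]; omega
    | some c =>
      have := length_le_sum q c
      by_cases e' : (q c).length < cfg.cacheCap c
      · simp [exec, e, e', pops, pushes, weight, steps, SameWords]
      · simp only [exec, e, e', pops, pushes, weight, steps, SameWords, if_false]
        omega
  | flush c p =>
    cases e : q c <;> simp [exec, e, pops, pushes, weight, steps, SameWords]; omega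
  | gather c p d head tail n =>
    cases e : q c with
    | nil => simp [exec, e, pops, pushes, weight, steps, SameWords]
    | cons b L =>
      by_cases e' : sbOf b = d <;> simp [exec, e, e', pops, pushes, weight, steps, SameWords]; omega
  | flCas c p d head tail n old =>
    by_cases e : h.anchor d = old
    · simp only [exec, e, pops, pushes, if_true]
      left
      split_ifs <;> simp only [weight, Cont.weight] <;> omega
    · simp [exec, e, pops, pushes, weight, steps, SameWords]
  | rsLoad c d =>
    by_cases e : (h.anchor d).state = .EMPTY <;>
      simp [exec, e, pops, pushes, weight, Cont.weight, steps, SameWords]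
  | exLoad c =>
    by_cases e : h.used < cfg.capacity <;>
      simp [exec, e, pops, pushes, weight, steps, SameWords]
  | lgLoad m =>
    by_cases e : h.used + m ≤ cfg.capacity <;>
      simp [exec, e, pops, pushes, weight, steps, SameWords]
  | ppCas c old d next =>
    by_cases e : h.partialHead c = old <;>
      simp [exec, e, pops, pushes, weight, steps, SameWords]
  | qpCas c p d old =>
    by_cases e : h.partialHead c = old <;>
      simp [exec, e, pops, pushes, weight, steps, SameWords]; omega
  | pfCas c old d next =>
    by_cases e : h.freeHead = old <;>
      simp [exec, e, pops, pushes, weight, steps, SameWords]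
  | rsCas c d old =>
    by_cases e : h.anchor d = old <;>
      simp [exec, e, pops, pushes, weight, steps, SameWords]
  | ppNext c old d =>
    by_cases e : h.partialHead c = old <;>
      simp [exec, e, pops, pushes, weight, steps, SameWords]
  | pfNext c old d =>
    by_cases e : h.freeHead = old <;>
      simp [exec, e, pops, pushes, weight, steps, SameWords]
  | pushNext first last old k =>
    by_cases e : h.freeHead = old <;>
      simp [exec, e, pops, pushes, weight, steps, SameWords]
  | flNext c p d head tail n old =>
    by_cases e : h.anchor d = old <;>
      simp [exec, e, pops, pushes, weight, steps, SameWords]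
  | qpNext c p d old =>
    by_cases e : h.partialHead c = old <;>
      simp [exec, e, pops, pushes, weight, steps, SameWords]
  | _ => simp [exec, pops, pushes, weight, Cont.weight, steps, SameWords]

/-! ### Descent of the measure along executions -/

section
variable [Fintype T]

/-- Bound on the number of successful CAS operations in an execution without responses. -/
def potential (s : Sys cfg T) (γ : Ghost cfg T) : ℕ :=
  -- The factor 2 exceeds by one the rise in weight of the thread that pops from a partial list or
  -- extends the prefix.
  2 * (cfg.capacity - s.heap.used) + 2 * γ.partLen + ∑ t, weight (s.cache t) (s.pc t)

/-- Bound on the number of steps until the next successful CAS operation. -/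
def distance (s : Sys cfg T) : ℕ := ∑ t, steps s.heap (s.cache t) (s.pc t)

/-- A step other than a response preserves the invariant and decreases the measure, except that
stores by the application may keep it. -/
theorem Step.exists_inv [DecidableEq T] {s s' : Sys cfg T} {e : Event T} {γ : Ghost cfg T}
    (hi : Inv s γ) (hs : Step s e s') : ∃ γ', Inv s' γ' ∧ (¬ e.IsResponse →
      potential s' γ' < potential s γ ∨ potential s' γ' = potential s γ ∧
        (distance s' < distance s ∨ ¬ e.IsInternal ∧ distance s' = distance s)) := by
  obtain ⟨G, hl⟩ := hi
  have split : ∀ (t : T) (f : T → ℕ), ∑ t', f t' = f t + ∑ t' ∈ Finset.univ.erase t, f t' :=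
    fun t f => (Finset.add_sum_erase _ f (Finset.mem_univ t)).symm
  cases hs with
  | callMalloc t n idle =>
    refine ⟨γ, ⟨G, fun t' => ⟨(hl t').1, ?_⟩⟩, fun _ => .inl ?_⟩
    · by_cases ht : t' = t
      · subst ht; simp [PCInv]
      · simpa [ht] using (hl t').2
    · have : ∀ t' ∈ Finset.univ.erase t, weight (s.cache t')
          (Function.update s.pc t (.mallocStart n) t') = weight (s.cache t') (s.pc t') :=
        fun t' ht => by rw [Function.update_of_ne (Finset.ne_of_mem_erase ht)]
      simp only [potential, split t, Function.update_self]
      rw [Finset.sum_congr rfl this, idle]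
      simp only [weight]
      omega
  | callFree t p idle inUse =>
    obtain ⟨h1, h2, h3⟩ := G.callFree t inUse
    refine ⟨_, ⟨h1, fun t' => ⟨(h2 t').cacheInv (hl t').1, ?_⟩⟩, fun _ => .inl ?_⟩
    · by_cases ht : t' = t
      · subst ht; simpa using h3
      · simpa [ht] using (h2 t').pcInv (hl t').2
    · have : ∀ t' ∈ Finset.univ.erase t, weight (s.cache t')
          (Function.update s.pc t (.freeStart p) t') = weight (s.cache t') (s.pc t') :=
        fun t' ht => by rw [Function.update_of_ne (Finset.ne_of_mem_erase ht)]
      simp only [potential, split t, Function.update_self]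
      rw [Finset.sum_congr rfl this, idle]
      simp only [weight, Ghost.partLen]
      omega
  | internal t not_idle not_ret =>
    obtain ⟨γ', h1, h2, h3, h4⟩ := exec_invariant G (hl t).1 (hl t).2
    have h5 := exec_measure (q := s.cache t) (hl t).2 not_idle not_ret
    refine ⟨γ', ⟨h1.ginv, fun t' => ?_⟩, fun _ => ?_⟩
    · by_cases ht : t' = t
      · subst ht; simpa using ⟨h2, h3⟩
      · simpa [ht] using ⟨(h1.stable t' ht).cacheInv (hl t').1, (h1.stable t' ht).pcInv (hl t').2⟩
    · obtain ⟨r, hr⟩ : ∃ r, r = exec s.heap (s.cache t) (s.pc t) := ⟨_, rfl⟩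
      rw [← hr] at h5 ⊢
      have hw : ∀ t' ∈ Finset.univ.erase t, weight (Function.update s.cache t r.2.2 t')
          (Function.update s.pc t r.1 t') = weight (s.cache t') (s.pc t') := fun t' ht => by
        simp only [Function.update_of_ne (Finset.ne_of_mem_erase ht)]
      have hd : ∀ t' ∈ Finset.univ.erase t, steps r.2.1 (Function.update s.cache t r.2.2 t')
          (Function.update s.pc t r.1 t') = steps r.2.1 (s.cache t') (s.pc t') := fun t' ht => by
        simp only [Function.update_of_ne (Finset.ne_of_mem_erase ht)]
      simp only [potential, distance, split t, Finset.sum_congr rfl hw, Finset.sum_congr rfl hd,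
        Function.update_self]
      -- In the first case the distance may grow arbitrarily, which the lexicographic order allows.
      rcases h5 with h5 | ⟨h5, h6, h7, h8, h9⟩
      · left
        omega
      · simp only [h5.steps_eq _ (s.pc _), h5.1]
        omega
  | response t v at_ret =>
    cases v with
    | none =>
      refine ⟨γ, ⟨by simpa using G, fun t' => ⟨(hl t').1, ?_⟩⟩,
        fun hn => absurd ⟨t, none, rfl⟩ hn⟩
      by_cases ht : t' = t
      · subst ht; simp [PCInv]
      · simpa [ht] using (hl t').2
    | some p =>
      have hp := (hl t).2
      rw [at_ret] at hp
      have h1 := G.response hp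
      refine ⟨{ γ with place := Function.update γ.place p .live }, ⟨?_, fun t' => ?_⟩,
        fun hn => absurd ⟨t, some p, rfl⟩ hn⟩
      · have : {a | some p = some a} = ({p} : Set ℕ) := by ext; simp [eq_comm]
        rw [this]
        exact h1.ginv
      · by_cases ht : t' = t
        · subst ht
          refine ⟨fun c => ⟨((hl t').1 c).1, fun a ha => ?_⟩, by simp [PCInv]⟩
          obtain ⟨h3, h4⟩ := ((hl t').1 c).2 a ha
          have : a ≠ p := by
            rintro rfl
            rcases hp with ⟨c', h5, -⟩ | ⟨h5, -⟩ <;> simp [h5] at h3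
          exact ⟨(Function.update_of_ne this _ _).trans h3, h4⟩
        · simpa [ht] using
            And.intro ((h1.stable t' ht).cacheInv (hl t').1) ((h1.stable t' ht).pcInv (hl t').2)
  | store a x w inUse lower upper =>
    obtain ⟨h1, h2⟩ := G.store (w := w) inUse lower upper
    refine ⟨γ, ⟨h1, fun t' => ⟨(h2 t').cacheInv (hl t').1, (h2 t').pcInv (hl t').2⟩⟩,
      fun _ => .inr ⟨rfl, .inr ⟨by simp [Event.IsInternal], ?_⟩⟩⟩
    refine Finset.sum_congr rfl fun t' _ => SameWords.steps_eq ⟨rfl, rfl, rfl, rfl⟩ _ _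

/-- An execution without responses takes finitely many steps inside the allocator. -/
theorem Execution.false_of_no_response [DecidableEq T] (x : Execution cfg T)
    (hf : ∃ᶠ n in Filter.atTop, (x.event n).IsInternal) (A B k n : ℕ) (γ : Ghost cfg T)
    (hi : Inv (x.state n) γ) (hn : ∀ m ≥ n, ¬ (x.event m).IsResponse)
    (hA : potential (x.state n) γ = A) (hB : distance (x.state n) = B)
    (hk : (x.event (n + k)).IsInternal) : False := by
  -- Lexicographic descent on potential and distance. The innermost induction, on the number `k` of
  -- events before a step inside the allocator, handles stores, which may leave both unchanged.
  induction A using Nat.strong_induction_on generalizing B k n γ with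
  | _ A ihA =>
  induction B using Nat.strong_induction_on generalizing k n γ with
  | _ B ihB =>
  -- Whenever potential or distance drops, the waiting time starts anew; a bound for it exists
  -- because steps inside the allocator recur.
  have next : ∃ k, (x.event (n + 1 + k)).IsInternal := by
    obtain ⟨m, hm, hm'⟩ := Filter.frequently_atTop.1 hf (n + 1)
    obtain ⟨k, rfl⟩ := Nat.exists_eq_add_of_le hm
    exact ⟨k, hm'⟩
  induction k generalizing n γ with
  | zero =>
    obtain ⟨γ', h1, h2⟩ := (x.step n).exists_inv hi
    obtain ⟨k', hk'⟩ := next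
    have hn' : ∀ m ≥ n + 1, ¬ (x.event m).IsResponse := fun m hm => hn m (by omega)
    rcases h2 (hn n le_rfl) with h2 | ⟨h2, h3 | h3⟩
    · exact ihA _ (hA ▸ h2) _ k' (n + 1) γ' h1 hn' rfl rfl hk'
    · exact ihB _ (hB ▸ h3) k' (n + 1) γ' h1 hn' (h2.trans hA) rfl hk'
    · exact h3.1 hk
  | succ k ihk =>
    obtain ⟨γ', h1, h2⟩ := (x.step n).exists_inv hi
    have hk' : (x.event (n + 1 + k)).IsInternal := by rwa [Nat.add_assoc, Nat.add_comm 1 k]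
    have hn' : ∀ m ≥ n + 1, ¬ (x.event m).IsResponse := fun m hm => hn m (by omega)
    rcases h2 (hn n le_rfl) with h2 | ⟨h2, h3 | h3⟩
    · exact ihA _ (hA ▸ h2) _ k (n + 1) γ' h1 hn' rfl rfl hk'
    · exact ihB _ (hB ▸ h3) k (n + 1) γ' h1 hn' (h2.trans hA) rfl hk'
    · refine ihk (n + 1) γ' h1 hn' (h2.trans hA) (h3.2.trans hB) hk' ?_
      obtain ⟨m, hm, hm'⟩ := Filter.frequently_atTop.1 hf (n + 1 + 1)
      obtain ⟨j, rfl⟩ := Nat.exists_eq_add_of_le hm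
      exact ⟨j, hm'⟩

lemma Execution.exists_inv [DecidableEq T] (x : Execution cfg T) (n : ℕ) :
    ∃ γ, Inv (x.state n) γ := by
  induction n with
  | zero => exact x.initial.exists_inv
  | succ n ih =>
    obtain ⟨γ, hi⟩ := ih
    obtain ⟨γ', h, -⟩ := (x.step n).exists_inv hi
    exact ⟨γ', h⟩

end

/-- A thread inside the allocator can always take a step. -/
lemma exists_step [DecidableEq T] (s : Sys cfg T) (t : T) (ht : s.pc t ≠ .idle) :
    ∃ e s', e.thread? = some t ∧ Step s e s' := by
  by_cases hr : ∃ v, s.pc t = .ret v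
  · obtain ⟨v, hv⟩ := hr
    exact ⟨.response t v, _, rfl, .response s t v hv⟩
  · exact ⟨.internal t, _, rfl, .internal s t ht fun v hv => hr ⟨v, hv⟩⟩

end Ralloc

theorem theorem3 (cfg : Ralloc.Config) (T : Type*) [Finite T] [DecidableEq T] :
    Ralloc.LockFree cfg T := by
  have := Fintype.ofFinite T
  refine ⟨fun s _ t ht => Ralloc.exists_step s t ht, fun x hf => ?_⟩
  -- After `N` there are no responses, and the descent is started from the state at `N`.
  by_contra hr
  obtain ⟨N, hN⟩ := Filter.eventually_atTop.1 (Filter.not_frequently.1 hr)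
  obtain ⟨γ, hγ⟩ := x.exists_inv N
  obtain ⟨m, hm, hm'⟩ := Filter.frequently_atTop.1 hf N
  obtain ⟨k, rfl⟩ := Nat.exists_eq_add_of_le hm
  exact x.false_of_no_response hf _ _ k N γ hγ hN rfl rfl hm'
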